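/- Let $F_\chi$ be the Fock space with vacuum $|0\rangle$ of the Lie algebra with generators $\chi_m$, $m\in\mathbb Z+\frac12$, and relations $[\chi_m,\chi_n]=(-1)^{m-\frac12}\delta_{m,-n}$, where $\chi_m|0\rangle=0$ for $m>0$ (over $\mathbb C$). It has the basis of all monomials in the $\chi_{-j}$, $j\in\frac12+\mathbb Z_{\ge0}$, applied to $|0\rangle$. With $:\ :$ the normal ordered product (annihilation modes to the right), put $$h^{\mathbb Z}_n=\tfrac12\sum_{a+b=2n}:\chi_a\chi_b:\quad(n\in\mathbb Z),\qquad L_0=\sum_{k\in\mathbb Z}\frac{1+4k}{4}:\chi_{2k+\frac12}\chi_{-2k-\frac12}:,\qquad L^h_0=-\tfrac12\sum_{n\in\mathbb Z}:h^{\mathbb Z}_{n}h^{\mathbb Z}_{-n}:,$$ that is, $h^{\mathbb Z}_n$ are the modes of the untwisted Heisenberg field $h(z)=\frac1{4z}\left(:\chi(z)\chi(z):-:\chi(-z)\chi(-z):\right)=\sum_n h^{\mathbb Z}_nz^{-2n-2}$, where $\chi(z)=\sum_m\chi_mz^{-m-\frac12}$; $L_0$ is the degree operator, with $2L_0\,\chi_{-j_1}\cdots\chi_{-j_k}|0\rangle=(j_1+\dots+j_k)\,\chi_{-j_1}\cdots\chi_{-j_k}|0\rangle$;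 and $L^h_0$ is the zero mode of the Virasoro field $-\frac12:h(z)^2:$. Let $\mathfrak{BP}_{DI}$ be the set of bipartitions $(\pi_1|\pi_2)$ in which each of $\pi_1,\pi_2$ is a (possibly empty) partition into distinct positive integers. For $n=\#\pi_1$, $s=\#\pi_2$ (numbers of parts) let $\mathrm{birank}(\pi_1|\pi_2)=s-n$ and $$\mathcal W(\pi_1|\pi_2)=2\left(|\pi_1|+|\pi_2|\right)+2ns-\frac{n(2n-1)}2-\frac{s(2s+1)}2\in\tfrac12\mathbb Z_{\ge0}.$$ **Theorem.** $F_\chi$ is the direct sum of the simultaneous eigenspaces of $2L_0$, $h^{\mathbb Z}_0$, $L^h_0$; the eigenvalues lie in $\frac12\mathbb Z_{\ge0}$, $\mathbb Z$ and $\frac12\mathbb Z$ respectively, and all the simultaneous eigenspaces are finite dimensional. As formal power series in $q^{1/2}$ whose coefficients are Laurent polynomials in $z$ and $r^{1/2}$, $$\mathrm{tr}_{F_\chi}\,q^{2L_0}z^{h^{\mathbb Z}_0}r^{L^h_0}=\sum_{(\pi_1|\pi_2)\in\mathfrak{BP}_{DI}}\frac{q^{\mathcal W(\pi_1|\pi_2)}\,z^{\mathrm{birank}(\pi_1|\pi_2)}\,r^{-\mathrm{birank}(\pi_1|\pi_2)^2/2}}{\prod_{n\ge1}(1-q^{2n}r^n)},$$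 where the trace is the series whose coefficient of $q^\alpha z^\beta r^\gamma$ is the dimension of the simultaneous eigenspace for the eigenvalues $\alpha,\beta,\gamma$, and where the product and the sum on the right converge as formal series and the product is invertible. -/

import Mathlib

open scoped PowerSeries.WithPiTopology

noncomputable section

namespace CKP

/-! ### Locally finite sums of operators and normally ordered products of fields -/

section Fields

variable {V : Type*} [AddCommGroup V] [Module ℂ V]

/-- A sequence of operators `a n`, `n ∈ ℤ`, consists of the modes of a field if every vector is
annihilated by all modes of sufficiently large index. -/
def IsField (a : ℤ → Module.End ℂ V) : Prop :=
  ∀ v : V, ∃ N : ℤ, ∀ n : ℤ, N ≤ n → a n v = 0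

/-- The sum of a family of operators of which only finitely many act nontrivially on any given
vector. -/
def locallyFiniteSum (T : ℤ → Module.End ℂ V) (hT : ∀ v, {i | T i v ≠ 0}.Finite) :
    Module.End ℂ V where
  toFun v := ∑ᶠ i, T i v
  map_add' v w := by
    simp only [map_add]
    exact finsum_add_distrib (hT v) (hT w)
  map_smul' c v := by
    simp only [map_smul, RingHom.id_apply]
    exact (smul_finsum c _).symm

/-- The normally ordered product `:a_i b_j:`; annihilation modes (index `≥ 0`) of `a` are moved
to the right. -/
def normalOrdered (a b : ℤ → Module.End ℂ V) (i j : ℤ) : Module.End ℂ V :=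
  if 0 ≤ i then b j * a i else a i * b j

theorem normalOrdered_finite {a b : ℤ → Module.End ℂ V} (ha : IsField a) (hb : IsField b)
    (c : ℤ → ℂ) (N : ℤ) (v : V) :
    {i | (c i • normalOrdered a b i (N - i)) v ≠ 0}.Finite := by
  obtain ⟨A, hA⟩ := ha v
  obtain ⟨B, hB⟩ := hb v
  refine (Set.finite_Icc (min (N - B) 0) (max A 0)).subset ?_
  intro i hi
  by_contra hcon
  apply hi
  rw [Set.mem_Icc, not_and_or, not_le, not_le] at hcon
  unfold normalOrdered
  rcases hcon with h | h
  · have h0 : ¬ 0 ≤ i := by omega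
    simp [h0, hB (N - i) (by omega)]
  · have h0 : 0 ≤ i := by omega
    simp [h0, hA i (by omega)]

/-- The operator `∑_{i + j = N} c_i :a_i b_j:`. -/
def normalSum (a b : ℤ → Module.End ℂ V) (ha : IsField a) (hb : IsField b) (c : ℤ → ℂ) (N : ℤ) :
    Module.End ℂ V :=
  locallyFiniteSum (fun i => c i • normalOrdered a b i (N - i)) (normalOrdered_finite ha hb c N)

end Fields

/-! ### The Fock space of the CKP hierarchy -/

/-- The Fock space `F_χ`, realized on the polynomial algebra in the variables
`X k = χ_{-(k + 1/2)}`, `k = 0, 1, 2, …`. -/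
abbrev Fock : Type := MvPolynomial ℕ ℂ

/-- The vacuum vector `|0⟩`. -/
def vacuum : Fock := 1

/-- `χ m` is the mode `χ_{m + 1/2}`, `m ∈ ℤ`. The creation operator `χ_{-(k + 1/2)}` multiplies
by `X k`, the annihilation operator `χ_{k + 1/2}` is `(-1)^k ∂/∂X k`. -/
def χ : ℤ → Module.End ℂ Fock
  | Int.ofNat k => ((-1 : ℂ) ^ k) • (MvPolynomial.pderiv k).toLinearMap
  | Int.negSucc k => LinearMap.mulLeft ℂ (MvPolynomial.X k)

theorem χ_ofNat_apply (k : ℕ) (v : Fock) :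
    χ (Int.ofNat k) v = ((-1 : ℂ) ^ k) • MvPolynomial.pderiv k v := rfl

theorem χ_negSucc_apply (k : ℕ) (v : Fock) :
    χ (Int.negSucc k) v = MvPolynomial.X k * v := rfl

theorem pderiv_pderiv_comm (k l : ℕ) (v : Fock) :
    MvPolynomial.pderiv k (MvPolynomial.pderiv l v)
      = MvPolynomial.pderiv l (MvPolynomial.pderiv k v) := by
  have h : ⁅(MvPolynomial.pderiv k : Derivation ℂ Fock Fock),
      (MvPolynomial.pderiv l : Derivation ℂ Fock Fock)⁆ = 0 := by
    refine MvPolynomial.derivation_ext fun i => ?_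
    rw [Derivation.commutator_apply]
    simp only [MvPolynomial.pderiv_X, Pi.single_apply, Derivation.zero_apply]
    split_ifs <;> simp
  have h2 := congrArg (fun D : Derivation ℂ Fock Fock => D v) h
  simp only [Derivation.commutator_apply, Derivation.zero_apply] at h2
  exact sub_eq_zero.mp h2

/-- The commutation relations `[χ_a, χ_b] = (-1)^{a - 1/2} δ_{a, -b}`, with `a = m + 1/2` and
`b = n + 1/2`. -/
theorem χ_comm (m n : ℤ) :
    χ m * χ n - χ n * χ m = if m + n + 1 = 0 then ((-1 : ℂ) ^ m) • 1 else 0 := by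
  refine LinearMap.ext fun v => ?_
  rcases m with k | k <;> rcases n with l | l
  · have h : ¬ (Int.ofNat k + Int.ofNat l + 1 = 0) := by
      simp only [Int.ofNat_eq_natCast]; omega
    rw [if_neg h]
    simp only [LinearMap.sub_apply, Module.End.mul_apply, χ_ofNat_apply, map_smul,
      LinearMap.zero_apply]
    rw [pderiv_pderiv_comm k l, smul_comm, sub_self]
  · simp only [LinearMap.sub_apply, Module.End.mul_apply, χ_ofNat_apply, χ_negSucc_apply,
      Derivation.leibniz, MvPolynomial.pderiv_X, smul_eq_mul, smul_add, mul_smul_comm,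
      add_sub_cancel_left]
    by_cases h : k = l
    · subst h
      have h' : Int.ofNat k + Int.negSucc k + 1 = 0 := by
        simp only [Int.ofNat_eq_natCast]; omega
      rw [if_pos h']
      simp
    · have h' : ¬ (Int.ofNat k + Int.negSucc l + 1 = 0) := by
        simp only [Int.ofNat_eq_natCast]; omega
      rw [if_neg h']
      simp [Ne.symm h]
  · simp only [LinearMap.sub_apply, Module.End.mul_apply, χ_ofNat_apply, χ_negSucc_apply,
      Derivation.leibniz, MvPolynomial.pderiv_X, smul_eq_mul, smul_add, mul_smul_comm,
      sub_add_cancel_left]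
    by_cases h : k = l
    · subst h
      have h' : Int.negSucc k + Int.ofNat k + 1 = 0 := by
        simp only [Int.ofNat_eq_natCast]; omega
      rw [if_pos h']
      simp [zpow_negSucc, pow_succ, ← inv_pow]
    · have h' : ¬ (Int.negSucc k + Int.ofNat l + 1 = 0) := by
        simp only [Int.ofNat_eq_natCast]; omega
      rw [if_neg h']
      simp [h]
  · have h : ¬ (Int.negSucc k + Int.negSucc l + 1 = 0) := by omega
    rw [if_neg h]
    simp only [LinearMap.sub_apply, Module.End.mul_apply, χ_negSucc_apply, LinearMap.zero_apply]
    ring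

theorem χ_vacuum (m : ℤ) (hm : 0 ≤ m) : χ m vacuum = 0 := by
  obtain ⟨k, rfl⟩ := Int.eq_ofNat_of_zero_le hm
  change ((-1 : ℂ) ^ k) • MvPolynomial.pderiv k (1 : Fock) = 0
  simp

/-- `F_χ` is the induced vacuum module: whenever operators `ψ m` satisfy the same commutation
relations and `w` is annihilated by all `ψ m` with `m ≥ 0`, there is exactly one homomorphism from
`F_χ` that intertwines the operators and maps the vacuum to `w`. -/
theorem fock_universal {W : Type*} [AddCommGroup W] [Module ℂ W] (ψ : ℤ → Module.End ℂ W)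
    (hψ : ∀ m n : ℤ,
      ψ m * ψ n - ψ n * ψ m = if m + n + 1 = 0 then ((-1 : ℂ) ^ m) • 1 else 0)
    (w : W) (hw : ∀ m : ℤ, 0 ≤ m → ψ m w = 0) :
    ∃! f : Fock →ₗ[ℂ] W, f vacuum = w ∧ ∀ m v, f (χ m v) = ψ m (f v) := by
  have hC : ∀ (f : Fock →ₗ[ℂ] W), f vacuum = w → ∀ a : ℂ, f (MvPolynomial.C a) = a • w := by
    intro f hf a
    rw [← hf, ← map_smul, vacuum, MvPolynomial.C_eq_smul_one]
  have hcomm : ∀ a ∈ Set.range (fun k : ℕ => ψ (Int.negSucc k)),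
      ∀ b ∈ Set.range (fun k : ℕ => ψ (Int.negSucc k)), a * b = b * a := by
    rintro _ ⟨k, rfl⟩ _ ⟨l, rfl⟩
    have h := hψ (Int.negSucc k) (Int.negSucc l)
    rw [if_neg (by omega)] at h
    exact sub_eq_zero.mp h
  obtain ⟨f, hf1, hfX⟩ : ∃ f : Fock →ₗ[ℂ] W, f vacuum = w ∧
      ∀ k v, f (MvPolynomial.X k * v) = ψ (Int.negSucc k) (f v) := by
    have hA := Algebra.isMulCommutative_adjoin ℂ hcomm
    let _ : CommRing (Algebra.adjoin ℂ (Set.range (fun k : ℕ => ψ (Int.negSucc k)))) :=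
      { (Algebra.adjoin ℂ (Set.range (fun k : ℕ => ψ (Int.negSucc k)))).toRing with
        mul_comm := hA.is_comm.comm }
    let g : Fock →ₐ[ℂ] Algebra.adjoin ℂ (Set.range (fun k : ℕ => ψ (Int.negSucc k))) :=
      MvPolynomial.aeval (fun k => ⟨ψ (Int.negSucc k), Algebra.subset_adjoin ⟨k, rfl⟩⟩)
    refine ⟨⟨⟨fun v => (g v).1 w, fun v v' => ?_⟩, fun c v => ?_⟩, ?_, fun k v => ?_⟩
    · rw [map_add]; rfl
    · change (g (c • v)).1 w = c • (g v).1 w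
      rw [map_smul]; rfl
    · change (g 1).1 w = w
      rw [map_one]; rfl
    · change (g (MvPolynomial.X k * v)).1 w = ψ (Int.negSucc k) ((g v).1 w)
      rw [map_mul, MvPolynomial.aeval_X]; rfl
  refine ⟨f, ⟨hf1, ?_⟩, ?_⟩
  · intro m v
    rcases m with k | k
    · induction v using MvPolynomial.induction_on with
      | C a =>
        rw [χ_ofNat_apply, MvPolynomial.pderiv_C, smul_zero, map_zero, hC f hf1, map_smul,
          hw (Int.ofNat k) (Int.natCast_nonneg k), smul_zero]
      | add p p' hp hp' => simp only [map_add, hp, hp']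
      | mul_X p l hp =>
        have h1 := congrArg (fun T : Module.End ℂ Fock => f (T p))
          (χ_comm (Int.ofNat k) (Int.negSucc l))
        have h2 := congrArg (fun T : Module.End ℂ W => T (f p)) (hψ (Int.ofNat k) (Int.negSucc l))
        have h3 : f ((if Int.ofNat k + Int.negSucc l + 1 = 0 then
            ((-1 : ℂ) ^ (Int.ofNat k)) • (1 : Module.End ℂ Fock) else 0) p)
            = (if Int.ofNat k + Int.negSucc l + 1 = 0 then
            ((-1 : ℂ) ^ (Int.ofNat k)) • (1 : Module.End ℂ W) else 0) (f p) := by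
          split_ifs <;> simp
        simp only [h3, LinearMap.sub_apply, Module.End.mul_apply, map_sub, χ_negSucc_apply, hfX,
          hp] at h1 h2
        rw [mul_comm p]
        rw [← h2] at h1
        rw [hfX]
        exact sub_left_inj.mp h1
    · rw [χ_negSucc_apply, hfX]
  · rintro g ⟨hg1, hg⟩
    refine LinearMap.ext fun v => ?_
    induction v using MvPolynomial.induction_on with
    | C a => rw [hC f hf1, hC g hg1]
    | add p p' hp hp' => rw [map_add, map_add, hp, hp']
    | mul_X p l hp =>
      rw [mul_comm, hfX, ← hp, ← χ_negSucc_apply, hg]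

theorem isField_χ : IsField χ := by
  intro v
  obtain ⟨M, hM⟩ := v.vars.exists_nat_subset_range
  refine ⟨M, fun n hn => ?_⟩
  obtain ⟨k, rfl⟩ := Int.eq_ofNat_of_zero_le (le_trans (Int.natCast_nonneg M) hn)
  change ((-1 : ℂ) ^ k) • MvPolynomial.pderiv k v = 0
  rw [MvPolynomial.pderiv_eq_zero_of_notMem_vars, smul_zero]
  intro hk
  have := Finset.mem_range.mp (hM hk)
  omega

/-! ### The untwisted Heisenberg field and the grading operators -/

/-- The mode `h^ℤ_n` of the untwisted Heisenberg field
`h(z) = (1/(4z)) (:χ(z)χ(z): - :χ(-z)χ(-z):) = ∑ h_n z^{-2n-2}`, where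
`χ(z) = ∑_{a ∈ ℤ + 1/2} χ_a z^{-a-1/2}`. Comparing coefficients,
`h_n = (1/2) ∑_{a + b = 2n} :χ_a χ_b:`; here `a = i + 1/2`, `b = j + 1/2`, `i + j = 2n - 1`. -/
def heis (n : ℤ) : Module.End ℂ Fock :=
  normalSum χ χ isField_χ isField_χ (fun _ => 1 / 2) (2 * n - 1)

theorem isField_heis : IsField heis := by
  intro v
  obtain ⟨M, hM⟩ := isField_χ v
  refine ⟨max M 1 + 1, fun n hn => ?_⟩
  change ∑ᶠ i, ((1 / 2 : ℂ) • normalOrdered χ χ i (2 * n - 1 - i)) v = 0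
  refine finsum_eq_zero_of_forall_eq_zero fun i => ?_
  unfold normalOrdered
  split_ifs with h
  · by_cases hi : M ≤ i
    · simp [hM i hi]
    · have hc := congrArg (fun T : Module.End ℂ Fock => T v) (χ_comm (2 * n - 1 - i) i)
      rw [if_neg (by omega)] at hc
      simp only [LinearMap.sub_apply, Module.End.mul_apply, LinearMap.zero_apply,
        hM (2 * n - 1 - i) (by omega), map_zero, sub_zero] at hc
      simp [hc]
  · simp [hM (2 * n - 1 - i) (by omega)]

theorem isField_χ_even : IsField fun k => χ (2 * k) := fun v => by
  obtain ⟨M, hM⟩ := isField_χ v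
  exact ⟨max M 0, fun n hn => hM _ (by omega)⟩

theorem isField_χ_odd : IsField fun l => χ (2 * l - 1) := fun v => by
  obtain ⟨M, hM⟩ := isField_χ v
  exact ⟨max M 1, fun n hn => hM _ (by omega)⟩

/-- The mode `L_n = ∑_{k + l = n} ((k + 1 - 3l)/4) :χ_{2k + 1/2} χ_{2l - 1/2}:` of the Virasoro
field of central charge `-1/4`. -/
def virL (n : ℤ) : Module.End ℂ Fock :=
  normalSum (fun k => χ (2 * k)) (fun l => χ (2 * l - 1)) isField_χ_even isField_χ_odd
    (fun k => ((k : ℂ) + 1 - 3 * ((n - k : ℤ) : ℂ)) / 4) n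

/-- The mode `L^h_n` of the Virasoro field `L^h(z²) = -(1/2) :h(z²)²: = ∑ L^h_n (z²)^{-n-2}`, that
is `L^h_n = -(1/2) ∑_{k + l = n} :h_k h_l:`. -/
def virLh (n : ℤ) : Module.End ℂ Fock :=
  normalSum heis heis isField_heis isField_heis (fun _ => -1 / 2) n

/-! ### Graded dimensions -/

/-- The ring of Laurent polynomials in `z` and `r^{1/2}`. -/
abbrev LaurentZR : Type := AddMonoidAlgebra ℤ (ℤ × ℤ)

/-- Laurent polynomials carry the discrete topology, so that convergence in the power series ring
over them is the usual convergence of formal series. -/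
instance : TopologicalSpace LaurentZR := ⊥

instance : DiscreteTopology LaurentZR := ⟨rfl⟩

/-- Formal power series in `q^{1/2}` whose coefficients are Laurent polynomials in `z` and
`r^{1/2}`. -/
abbrev SeriesQZR : Type := PowerSeries LaurentZR

/-- The monomial `q^{N/2} z^c r^{l/2}`. -/
def qzr (N : ℕ) (c l : ℤ) : SeriesQZR :=
  PowerSeries.monomial N (AddMonoidAlgebra.single (c, l) (1 : ℤ))

/-- The simultaneous eigenspace of three operators for the eigenvalues `α`, `β`, `γ`. -/
def jointEigenspace {V : Type*} [AddCommGroup V] [Module ℂ V] (A B C : Module.End ℂ V)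
    (α β γ : ℂ) : Submodule ℂ V :=
  A.eigenspace α ⊓ B.eigenspace β ⊓ C.eigenspace γ

/-- `HasTrace A B C f`: the trace `tr q^A z^B r^C` exists as a formal series in `q^{1/2}` over the
Laurent polynomials in `z` and `r^{1/2}`, and equals `f`. That is, `V` is the direct sum of the
simultaneous eigenspaces for the eigenvalues `(N/2, c, l/2)` with `N ∈ ℕ` and `c, l ∈ ℤ`, all of
them have finite dimension, and these dimensions are the coefficients of `q^{N/2} z^c r^{l/2}`
in `f`. -/
structure HasTrace {V : Type*} [AddCommGroup V] [Module ℂ V] (A B C : Module.End ℂ V)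
    (f : SeriesQZR) : Prop where
  isInternal : DirectSum.IsInternal fun i : ℕ × ℤ × ℤ =>
    jointEigenspace A B C ((i.1 : ℂ) / 2) (i.2.1 : ℂ) ((i.2.2 : ℂ) / 2)
  finiteDimensional : ∀ (N : ℕ) (c l : ℤ),
    FiniteDimensional ℂ (jointEigenspace A B C ((N : ℂ) / 2) (c : ℂ) ((l : ℂ) / 2))
  coeff_eq : ∀ (N : ℕ) (c l : ℤ), (PowerSeries.coeff N f).coeff (c, l)
    = (Module.finrank ℂ (jointEigenspace A B C ((N : ℂ) / 2) (c : ℂ) ((l : ℂ) / 2)) : ℤ)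

/-! ### Distinct integer bipartitions -/

/-- Bipartitions `(π₁ | π₂)` where `π₁` and `π₂` are partitions with distinct positive integer
parts, given by their sets of parts. -/
abbrev DistinctBipartition : Type := Finset ℕ+ × Finset ℕ+

namespace DistinctBipartition

/-- The weight `|(π₁ | π₂)|`, the sum of all parts. -/
def weight (π : DistinctBipartition) : ℕ := ∑ i ∈ π.1, (i : ℕ) + ∑ j ∈ π.2, (j : ℕ)

/-- The Hammond-Lewis birank `#π₂ - #π₁`. -/
def birank (π : DistinctBipartition) : ℤ := (π.2.card : ℤ) - (π.1.card : ℤ)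

/-- The weight function
`𝒲(π₁ | π₂) = 2 |(π₁ | π₂)| + 2 n s - n (2 n - 1) / 2 - s (2 s + 1) / 2`, `n = #π₁`, `s = #π₂`. -/
def W (π : DistinctBipartition) : ℚ :=
  2 * (weight π : ℚ) + 2 * (π.1.card : ℚ) * (π.2.card : ℚ)
    - (π.1.card : ℚ) * (2 * (π.1.card : ℚ) - 1) / 2
    - (π.2.card : ℚ) * (2 * (π.2.card : ℚ) + 1) / 2

/-- The natural number `2 𝒲(π₁ | π₂)`. -/
def twoW (π : DistinctBipartition) : ℕ := ⌊2 * W π⌋₊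

theorem card_mul_card_add_one_le (s : Finset ℕ+) :
    s.card * (s.card + 1) ≤ 2 * ∑ i ∈ s, (i : ℕ) := by
  induction s using Finset.induction_on_max with
  | empty => simp
  | insert a s hs ih =>
    have ha : a ∉ s := fun h => lt_irrefl _ (hs a h)
    have hc : s.card + 1 ≤ (a : ℕ) := by
      have hsub : s.map ⟨fun i : ℕ+ => (i : ℕ), PNat.coe_injective⟩ ⊆ Finset.Ico 1 (a : ℕ) := by
        intro x hx
        obtain ⟨i, hi, rfl⟩ := Finset.mem_map.mp hx
        exact Finset.mem_Ico.mpr ⟨i.2, hs i hi⟩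
      have h1 := Finset.card_le_card hsub
      rw [Finset.card_map, Nat.card_Ico] at h1
      have := a.pos
      omega
    rw [Finset.card_insert_of_notMem ha, Finset.sum_insert ha]
    nlinarith

theorem twoW_eq (π : DistinctBipartition) : (twoW π : ℚ) = 2 * W π := by
  have h1 : ((π.1.card : ℤ) * (π.1.card + 1)) ≤ 2 * ((∑ i ∈ π.1, (i : ℕ) : ℕ) : ℤ) := by
    exact_mod_cast card_mul_card_add_one_le π.1
  have h2 : ((π.2.card : ℤ) * (π.2.card + 1)) ≤ 2 * ((∑ i ∈ π.2, (i : ℕ) : ℕ) : ℤ) := by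
    exact_mod_cast card_mul_card_add_one_le π.2
  obtain ⟨k, hk⟩ : ∃ k : ℕ, (4 * (weight π : ℤ) + 4 * π.1.card * π.2.card
      - π.1.card * (2 * π.1.card - 1) - π.2.card * (2 * π.2.card + 1)) = k := by
    refine ⟨_, (Int.toNat_of_nonneg ?_).symm⟩
    have hw : (weight π : ℤ)
        = ((∑ i ∈ π.1, (i : ℕ) : ℕ) : ℤ) + ((∑ i ∈ π.2, (i : ℕ) : ℕ) : ℤ) := by
      simp only [weight, Nat.cast_add]
    have h3 : (0 : ℤ) ≤ (π.1.card : ℤ) * π.2.card := by positivity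
    rw [hw]
    nlinarith
  have hW : 2 * W π = k := by
    have hk' := congrArg (fun x : ℤ => (x : ℚ)) hk
    push_cast at hk'
    unfold W
    linarith
  rw [twoW, hW, Nat.floor_natCast]

end DistinctBipartition

end CKP

end

/-! The modes `heis n` form a Heisenberg algebra: they commute, except that $[h_m,h_{-m}]=-m$. A
lowering operator that satisfies a canonical commutation relation with a raising operator is
surjective when degrees are bounded below (`exists_preimage_of_comm`), even on the common kernel of
other such operators. By rank–nullity, imposing $h_n v=0$ multiplies the graded dimension by
$1-q^{2n}r^n$, because $h_{-n}$ raises $2L_0$ by $2n$ and $L^h_0$ by $n$. Hence the trace times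
$\prod(1-q^{2n}r^n)$ is the series of the highest weight vectors, those killed by all $h_n$, $n>0$.
The same surjectivity shows that $L^h_0$ is diagonalizable (`fockGrade_zero_le_iSup_virLh`).

On highest weight vectors $L^h_0=-h_0^2/2$, so the charge $c$ fixes the exponent of $r$ as $-c^2/2$.
It remains to count these vectors by degree and charge alone. The ladder argument for the $\chi_m$,
whose common kernel is the vacuum line, gives the series of $F_\chi$ as $1/((a)_\infty(b)_\infty)$
with $T=q^2$, $a=zq^{1/2}$, $b=z^{-1}q^{3/2}$ and Pochhammer symbols in base $T$. Since $ab=T$, the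
series of the highest weight vectors is
$$\frac{(T)_\infty}{(a)_\infty(b)_\infty}=\sum_{s,n}\frac{a^sb^nT^{sn}}{(T)_s(T)_n},$$ which follows
from Euler's identity and the Durfee rectangle identity (`tsum_doubleTerm_mul_qExp`). As $1/(T)_k$
generates partitions into $k$ distinct parts by their excess over the minimal sum $k(k+1)/2$, the
double sum is the sum over distinct bipartitions (`tsum_qzr_twoW`). -/

noncomputable section

namespace CKP

/-! ### Commutators with normally ordered sums -/

section Commutators

variable {V : Type*} [AddCommGroup V] [Module ℂ V]

theorem locallyFiniteSum_comm {T : ℤ → Module.End ℂ V} (hT : ∀ v, {i | T i v ≠ 0}.Finite)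
    (Y : Module.End ℂ V) (D : ℤ → V) (v : V) (hD : ∀ i, T i (Y v) = Y (T i v) + D i) :
    locallyFiniteSum T hT (Y v) = Y (locallyFiniteSum T hT v) + ∑ᶠ i, D i := by
  have h1 : (Function.support fun i => Y (T i v)).Finite :=
    (hT v).subset fun i hi h0 => hi (by simp [h0])
  have h2 : (Function.support D).Finite := by
    refine ((hT (Y v)).union h1).subset fun i hi => ?_
    by_contra hcon
    simp only [Set.mem_union, Set.mem_ofPred_eq, Function.mem_support, not_or, not_not] at hcon
    have := hD i
    rw [hcon.1, hcon.2, zero_add] at this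
    exact hi this.symm
  change ∑ᶠ i, T i (Y v) = Y (∑ᶠ i, T i v) + _
  rw [map_finsum Y (hT v), ← finsum_add_distrib h1 h2]
  exact finsum_congr hD

/-- Leibniz rule with scalar contractions: `Y` contracts with only one mode of each factor, so two
terms of the infinite sum survive. Reordering costs nothing, since the contractions are central. -/
theorem normalSum_comm_of_scalar {a b : ℤ → Module.End ℂ V} (ha : IsField a) (hb : IsField b)
    (c : ℤ → ℂ) (N : ℤ) (Y : Module.End ℂ V) (i₀ j₀ : ℤ) (α β : ℂ)
    (hα : ∀ i v, a i (Y v) = Y (a i v) + (if i = i₀ then α else 0) • v)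
    (hβ : ∀ j v, b j (Y v) = Y (b j v) + (if j = j₀ then β else 0) • v) (v : V) :
    normalSum a b ha hb c N (Y v) = Y (normalSum a b ha hb c N v)
      + ((c i₀ * α) • b (N - i₀) v + (c (N - j₀) * β) • a (N - j₀) v) := by
  unfold normalSum
  rw [locallyFiniteSum_comm _ Y (fun i => (if i = i₀ then (c i * α) • b (N - i) v else 0)
      + (if i = N - j₀ then (c i * β) • a i v else 0))]
  · congr 1
    rw [finsum_add_distrib, finsum_eq_single _ i₀, finsum_eq_single _ (N - j₀)]
    · simp
    · intro i hi; simp [hi]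
    · intro i hi; simp [hi]
    · exact (Set.finite_singleton i₀).subset fun i hi => by
        by_contra h; exact hi (if_neg h)
    · exact (Set.finite_singleton (N - j₀)).subset fun i hi => by
        by_contra h; exact hi (if_neg h)
  · intro i
    have hβ' : ∀ v, b (N - i) (Y v)
        = Y (b (N - i) v) + (if i = N - j₀ then β else 0) • v := fun v => by
      rw [hβ]
      simp only [show (N - i = j₀) ↔ i = N - j₀ by omega]
    simp only [LinearMap.smul_apply, normalOrdered]
    by_cases h0 : 0 ≤ i
    · simp only [if_pos h0, Module.End.mul_apply, hα, hβ', map_add, map_smul]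
      split_ifs <;> module
    · simp only [if_neg h0, Module.End.mul_apply, hα, hβ', map_add, map_smul]
      split_ifs <;> module

/-- Leibniz rule when each mode is an eigenvector of the commutator with `Y`: the weights of the two
factors add up, independently of their order. -/
theorem normalSum_comm_of_weight {a b : ℤ → Module.End ℂ V} (ha : IsField a) (hb : IsField b)
    (c : ℤ → ℂ) (N : ℤ) (Y : Module.End ℂ V) (α β : ℤ → ℂ) (ν : ℂ)
    (hα : ∀ i v, a i (Y v) = Y (a i v) + α i • a i v)
    (hβ : ∀ j v, b j (Y v) = Y (b j v) + β j • b j v) (hν : ∀ i, α i + β (N - i) = ν) (v : V) :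
    normalSum a b ha hb c N (Y v) = Y (normalSum a b ha hb c N v)
      + ν • normalSum a b ha hb c N v := by
  unfold normalSum
  rw [locallyFiniteSum_comm _ Y (fun i => ν • (c i • normalOrdered a b i (N - i)) v)]
  · rw [← smul_finsum]; rfl
  · intro i
    simp only [LinearMap.smul_apply, normalOrdered, ← hν i]
    split_ifs <;>
      simp only [Module.End.mul_apply, hα, hβ, map_add, map_smul, smul_add, add_smul] <;>
      simp only [smul_comm (c i)] <;> abel

end Commutators

/-! ### Relations between the $\chi_m$, the Heisenberg modes, $L_0$ and $L^h_0$ -/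

theorem χ_apply_comm (m n : ℤ) (v : Fock) :
    χ m (χ n v) = χ n (χ m v) + (if m = -1 - n then (-1 : ℂ) ^ (n + 1) else 0) • v := by
  have h := congrArg (fun T : Module.End ℂ Fock => T v) (χ_comm m n)
  simp only [LinearMap.sub_apply, Module.End.mul_apply] at h
  rw [sub_eq_iff_eq_add'.mp h]
  congr 1
  by_cases hm : m = -1 - n
  · rw [if_pos hm, if_pos (by omega), hm, LinearMap.smul_apply, Module.End.one_apply]
    congr 1
    rw [show -1 - n = -(n + 1) by ring, zpow_neg, ← inv_zpow]
    norm_num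
  · rw [if_neg hm, if_neg (by omega)]
    simp

/-- The two contractions in $\frac12:\chi\chi:$ yield the same term, which cancels the factor
$\frac12$. -/
theorem heis_χ (n m : ℤ) (v : Fock) :
    heis n (χ m v) = χ m (heis n v) + ((-1 : ℂ) ^ (m + 1)) • χ (m + 2 * n) v := by
  unfold heis
  rw [normalSum_comm_of_scalar isField_χ isField_χ _ _ (χ m) (-1 - m) (-1 - m) ((-1) ^ (m + 1))
    ((-1) ^ (m + 1)) (fun i v => χ_apply_comm i m v) (fun i v => χ_apply_comm i m v)]
  congr 1
  rw [show 2 * n - 1 - (-1 - m) = m + 2 * n by ring, ← add_smul]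
  congr 1
  ring

/-- In `virL` the first factor has even index and the second odd index. Since `χ m` contracts only
with index `-1 - m`, of opposite parity, exactly one of the factors contributes. -/
theorem virL_χ (m : ℤ) (v : Fock) :
    virL 0 (χ m v) = χ m (virL 0 v) + (-(2 * (m : ℂ) + 1) / 4) • χ m v := by
  unfold virL
  rcases Int.even_or_odd' m with ⟨p, rfl | rfl⟩
  · rw [normalSum_comm_of_scalar isField_χ_even isField_χ_odd _ _ (χ (2 * p)) 0 (-p) 0 (-1)]
    · congr 1
      simp only [mul_zero, zero_smul, zero_add, zero_sub, neg_neg]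
      congr 1
      push_cast
      ring
    · intro i v
      rw [χ_apply_comm, if_neg (by omega), ite_self]
    · intro i v
      rw [χ_apply_comm]
      by_cases h : i = -p
      · rw [if_pos h, if_pos (by omega), zpow_add₀ (by norm_num), zpow_mul]
        norm_num
      · rw [if_neg h, if_neg (by omega)]
  · rw [normalSum_comm_of_scalar isField_χ_even isField_χ_odd _ _ (χ (2 * p + 1)) (-p - 1) 0 1 0]
    · congr 1
      simp only [mul_zero, zero_smul, add_zero, zero_sub]
      rw [show 2 * -(-p - 1) - 1 = 2 * p + 1 by ring]
      congr 1
      push_cast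
      ring
    · intro i v
      rw [χ_apply_comm]
      by_cases h : i = -p - 1
      · rw [if_pos h, if_pos (by omega), show 2 * p + 1 + 1 = 2 * (p + 1) by ring, zpow_mul]
        norm_num
      · rw [if_neg h, if_neg (by omega)]
    · intro i v
      rw [χ_apply_comm, if_neg (by omega), ite_self]

theorem normalOrdered_χ_vacuum (i j : ℤ) (h : 0 ≤ i ∨ 0 ≤ j) :
    normalOrdered χ χ i j vacuum = 0 := by
  unfold normalOrdered
  split_ifs with h0
  · rw [Module.End.mul_apply, χ_vacuum i h0, map_zero]
  · rw [Module.End.mul_apply, χ_vacuum j (by omega), map_zero]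

theorem heis_vacuum (n : ℤ) (hn : 0 ≤ n) : heis n vacuum = 0 := by
  refine finsum_eq_zero_of_forall_eq_zero fun i => ?_
  simp only [LinearMap.smul_apply]
  rw [normalOrdered_χ_vacuum _ _ (by omega), smul_zero]

theorem virL_vacuum : virL 0 vacuum = 0 := by
  refine finsum_eq_zero_of_forall_eq_zero fun i => ?_
  simp only [LinearMap.smul_apply, normalOrdered]
  split_ifs with h
  · rw [Module.End.mul_apply, χ_vacuum _ (by omega), map_zero, smul_zero]
  · rw [Module.End.mul_apply, χ_vacuum _ (by omega), map_zero, smul_zero]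

theorem heis_virL (n : ℤ) (v : Fock) :
    heis n (virL 0 v) = virL 0 (heis n v) + (n : ℂ) • heis n v := by
  unfold heis
  refine normalSum_comm_of_weight isField_χ isField_χ _ _ (virL 0) (fun i => (2 * (i : ℂ) + 1) / 4)
    (fun i => (2 * (i : ℂ) + 1) / 4) n ?_ ?_ ?_ v
  · intro i v
    rw [virL_χ, add_assoc, ← add_smul]
    ring_nf
    simp
  · intro i v
    rw [virL_χ, add_assoc, ← add_smul]
    ring_nf
    simp
  · intro i
    push_cast
    ring

/-- An operator commuting with all `χ m` is determined by its value on the vacuum. -/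
theorem eq_mul_of_commute_χ (T : Module.End ℂ Fock) (hT : ∀ m v, T (χ m v) = χ m (T v))
    (v : Fock) : T v = v * T vacuum := by
  induction v using MvPolynomial.induction_on with
  | C a =>
    rw [MvPolynomial.C_eq_smul_one, map_smul, smul_mul_assoc, one_mul]
    rfl
  | add p q hp hq => rw [map_add, hp, hq, add_mul]
  | mul_X p k hp =>
    rw [mul_comm p, ← χ_negSucc_apply, hT, hp, χ_negSucc_apply, χ_negSucc_apply, mul_assoc]

/-- $L_0$ is built from the $\chi_m$, so this is the case of weight zero. -/
theorem virL_comm_of_commute_χ (T : Module.End ℂ Fock) (hT : ∀ m v, T (χ m v) = χ m (T v))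
    (v : Fock) : virL 0 (T v) = T (virL 0 v) := by
  have := normalSum_comm_of_weight isField_χ_even isField_χ_odd
    (fun k => ((k : ℂ) + 1 - 3 * ((0 - k : ℤ) : ℂ)) / 4) 0 T (fun _ => 0) (fun _ => 0) 0
    (fun i v => by simp [hT]) (fun i v => by simp [hT]) (fun i => by simp) v
  simpa [virL] using this

theorem heis_heis_vacuum (m : ℕ) : heis m (heis (-m) vacuum) = (-(m : ℂ)) • vacuum := by
  -- Only the terms of $h_{-m}|0\rangle$ with both modes creating survive, and there are $2m$ of
  -- them. In each, $h_m$ shifts one creation mode by $2m$: shifting the right one kills the vacuum,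
  -- shifting the left one contracts it with its neighbour and leaves $-\frac12$.
  have key : ∀ i : ℤ, heis m (((1 / 2 : ℂ) • normalOrdered χ χ i (2 * -m - 1 - i)) vacuum)
      = if i ∈ Finset.Ico (-2 * (m : ℤ)) 0 then (-1 / 2 : ℂ) • vacuum else 0 := by
    intro i
    rw [LinearMap.smul_apply, map_smul]
    split_ifs with hi
    · rw [Finset.mem_Ico] at hi
      unfold normalOrdered
      rw [if_neg (by omega), Module.End.mul_apply, heis_χ, heis_χ, heis_vacuum _ (by omega),
        χ_vacuum (2 * -m - 1 - i + 2 * m) (by omega), map_zero, smul_zero, add_zero, map_zero,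
        zero_add, χ_apply_comm, χ_vacuum (i + 2 * m) (by omega), map_zero, zero_add,
        if_pos (by omega), smul_smul, smul_smul, mul_assoc,
        ← zpow_add₀ (by norm_num : (-1 : ℂ) ≠ 0),
        show i + 1 + (2 * -(m : ℤ) - 1 - i + 1) = 2 * (-m) + 1 by ring,
        zpow_add₀ (by norm_num), zpow_mul]
      norm_num
    · rw [Finset.mem_Ico] at hi
      rw [normalOrdered_χ_vacuum _ _ (by omega), map_zero, smul_zero]
  change heis m (∑ᶠ i, _) = _
  rw [map_finsum _ (normalOrdered_finite isField_χ isField_χ _ _ _), finsum_congr key,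
    finsum_eq_sum_of_support_subset (s := Finset.Ico (-2 * (m : ℤ)) 0)]
  · rw [Finset.sum_ite_mem, Finset.inter_self, Finset.sum_const, Int.card_Ico,
      ← Nat.cast_smul_eq_nsmul ℂ, smul_smul]
    congr 1
    rw [show (0 - -2 * (m : ℤ)).toNat = 2 * m by omega]
    push_cast
    ring
  · intro i hi
    by_contra h
    exact hi (if_neg h)

/-- The commutator commutes with every $\chi_k$, so it is multiplication by its value on the vacuum.
For $m+n\ne0$ this value vanishes by degree: $L_0$ acts on it by $-(m+n)$, yet also by $0$, because
$L_0$ commutes with the commutator and kills the vacuum. -/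
theorem heis_comm_apply (m n : ℤ) (v : Fock) :
    heis m (heis n v) = heis n (heis m v) + (if m = -n then (n : ℂ) else 0) • v := by
  have hT : ∀ m n k v, (heis m * heis n - heis n * heis m) (χ k v)
      = χ k ((heis m * heis n - heis n * heis m) v) := by
    intro m n k v
    simp only [LinearMap.sub_apply, Module.End.mul_apply, heis_χ, map_add, map_smul, map_sub,
      smul_add]
    rw [show k + 2 * m + 2 * n = k + 2 * n + 2 * m by ring]
    have e : ∀ p : ℤ, (-1 : ℂ) ^ (k + 2 * p + 1) = (-1) ^ (k + 1) := fun p => by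
      rw [show k + 2 * p + 1 = 2 * p + (k + 1) by ring, zpow_add₀ (by norm_num), zpow_mul]
      norm_num
    rw [e, e]
    abel
  have h1 : ∀ m n v, heis m (heis n v) = heis n (heis m v)
      + v * (heis m (heis n vacuum) - heis n (heis m vacuum)) := fun m n v =>
    (sub_eq_iff_eq_add'.mp (eq_mul_of_commute_χ _ (hT m n) v))
  by_cases h : m = -n
  · rw [if_pos h, h1]
    congr 1
    subst h
    obtain ⟨p, rfl | rfl⟩ := Int.eq_nat_or_neg n
    · rw [heis_vacuum p (by omega), map_zero, zero_sub, heis_heis_vacuum]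
      simp [vacuum, MvPolynomial.smul_eq_C_mul, mul_comm]
    · rw [neg_neg, heis_vacuum p (by omega), map_zero, sub_zero, heis_heis_vacuum]
      simp [vacuum, MvPolynomial.smul_eq_C_mul, mul_comm]
  · rw [if_neg h, zero_smul, add_zero, h1]
    have h2 := virL_comm_of_commute_χ _ (hT m n) vacuum
    rw [virL_vacuum, map_zero] at h2
    simp only [LinearMap.sub_apply, Module.End.mul_apply, map_sub] at h2
    have h3 := heis_virL m (heis n vacuum)
    have h4 := heis_virL n (heis m vacuum)
    have h5 := heis_virL m vacuum
    have h6 := heis_virL n vacuum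
    rw [virL_vacuum, map_zero] at h5 h6
    have h5' := eq_neg_of_add_eq_zero_left h5.symm
    have h6' := eq_neg_of_add_eq_zero_left h6.symm
    rw [h6', map_neg, map_smul] at h3
    rw [h5', map_neg, map_smul] at h4
    have h7 : ((m : ℂ) + n) • (heis m (heis n vacuum) - heis n (heis m vacuum)) = 0 := by
      rw [← neg_eq_zero, ← h2, eq_sub_of_add_eq h3.symm, eq_sub_of_add_eq h4.symm]
      module
    have h8 : (m : ℂ) + n ≠ 0 := by
      intro h8
      apply h
      have : ((m + n : ℤ) : ℂ) = 0 := by push_cast; exact h8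
      have := Int.cast_eq_zero.mp this
      omega
    rw [(smul_eq_zero.mp h7).resolve_left h8, mul_zero, add_zero]

theorem virLh_heis (n : ℤ) (v : Fock) :
    virLh 0 (heis n v) = heis n (virLh 0 v) - (n : ℂ) • heis n v := by
  unfold virLh
  rw [normalSum_comm_of_scalar isField_heis isField_heis _ _ (heis n) (-n) (-n) n n
    (fun i v => heis_comm_apply i n v) (fun i v => heis_comm_apply i n v)]
  simp only [zero_sub, neg_neg]
  module

theorem heis_zero_comm (n : ℤ) (v : Fock) : heis 0 (heis n v) = heis n (heis 0 v) := by
  rw [heis_comm_apply]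
  by_cases h : 0 = -n
  · have : n = 0 := by omega
    simp [this]
  · simp [h]

theorem virLh_heis_zero (v : Fock) : virLh 0 (heis 0 v) = heis 0 (virLh 0 v) := by
  rw [virLh_heis]
  simp

theorem virLh_virL (v : Fock) : virLh 0 (virL 0 v) = virL 0 (virLh 0 v) := by
  have := normalSum_comm_of_weight isField_heis isField_heis (fun _ => -1 / 2) 0 (virL 0)
    (fun i => (i : ℂ)) (fun i => (i : ℂ)) 0 heis_virL heis_virL (fun i => by simp) v
  simpa [virLh] using this

/-- On a vector annihilated by all `h_k`, `k > 0`, the operator `L^h_0` acts as `-h_0² / 2`. -/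
theorem virLh_of_highest_weight (v : Fock) (hv : ∀ k : ℕ, heis (k + 1) v = 0) :
    virLh 0 v = (-1 / 2 : ℂ) • heis 0 (heis 0 v) := by
  change ∑ᶠ i, _ = _
  have hv' : ∀ k : ℤ, 0 < k → heis k v = 0 := fun k hk => by
    have := hv (k - 1).toNat
    rwa [show (((k - 1).toNat : ℤ) + 1) = k by omega] at this
  rw [finsum_eq_single _ 0]
  · simp [normalOrdered]
  · intro i hi
    simp only [LinearMap.smul_apply, normalOrdered]
    split_ifs with h
    · rw [Module.End.mul_apply, hv' i (by omega), map_zero, smul_zero]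
    · rw [Module.End.mul_apply, hv' _ (by omega), map_zero, smul_zero]

/-! ### Raising and lowering operators on a graded space -/

section Ladder

variable {V : Type*} [AddCommGroup V] [Module ℂ V]

/-- A lowering operator is surjective if it satisfies the canonical commutation relation with a
raising operator and the degrees are bounded below. -/
theorem exists_preimage_of_comm (M : ℤ × ℤ × ℤ → Submodule ℂ V) (a b : Module.End ℂ V) {κ : ℂ}
    (hκ : κ ≠ 0) (hab : ∀ v, a (b v) = b (a v) + κ • v) {d : ℤ × ℤ × ℤ} (hd : 0 < d.1)
    (ha : ∀ g, ∀ v ∈ M g, a v ∈ M (g - d)) (hb : ∀ g, ∀ v ∈ M g, b v ∈ M (g + d))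
    (h0 : ∀ g, g.1 < 0 → M g = ⊥) (g : ℤ × ℤ × ℤ) (w : V) (hw : w ∈ M g) :
    ∃ u ∈ M (g + d), a u = w := by
  -- With the ansatz that the preimage is $bu$, the equation becomes $(ba+\kappa)u=w$. Induction on
  -- the degree requires all $ba+j\kappa$ with $j\ge1$, since $a(ba+j\kappa)=(ba+(j+1)\kappa)a$.
  have key : ∀ n : ℕ, ∀ g : ℤ × ℤ × ℤ, g.1 < n → ∀ w ∈ M g, ∀ j : ℕ, 1 ≤ j →
      ∃ u ∈ M g, b (a u) + ((j : ℂ) * κ) • u = w := by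
    intro n
    induction n with
    | zero =>
      intro g hg w hw j _
      rw [h0 g (by exact_mod_cast hg), Submodule.mem_bot] at hw
      exact ⟨0, zero_mem _, by simp [hw]⟩
    | succ n ih =>
      intro g hg w hw j hj
      have hj0 : (j : ℂ) * κ ≠ 0 := mul_ne_zero (Nat.cast_ne_zero.mpr (by omega)) hκ
      obtain ⟨u, hu, hu'⟩ := ih (g - d) (by rw [Prod.fst_sub]; push_cast at hg; omega) (a w)
        (ha g w hw) (j + 1) (by omega)
      -- Here `u` solves the equation with right-hand side `a w` and `j + 1`. The commutation
      -- relation then shows that `a` maps the new witness to `u`, so that the terms `b u` cancel.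
      refine ⟨((j : ℂ) * κ)⁻¹ • (w - b u), (M g).smul_mem _ ((M g).sub_mem hw ?_), ?_⟩
      · simpa using hb _ u hu
      · have h1 : b (a w) = b (b (a u)) + (((j : ℂ) + 1) * κ) • b u := by
          rw [← hu']
          simp
        rw [smul_inv_smul₀ hj0]
        simp only [map_smul, map_sub, hab, map_add, h1]
        rw [add_sub_add_left_eq_sub, ← sub_smul, show ((j : ℂ) + 1) * κ - κ = j * κ by ring,
          inv_smul_smul₀ hj0]
        abel
  obtain ⟨u, hu, hu'⟩ := key (g.1.toNat + 1) g (by omega) w hw 1 le_rfl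
  refine ⟨b u, hb g u hu, ?_⟩
  rw [hab]
  simpa using hu'

/-- The common kernel of the first `m` operators of a sequence. -/
def commonKer (a : ℕ → Module.End ℂ V) (m : ℕ) : Submodule ℂ V :=
  ⨅ n : Fin m, LinearMap.ker (a n)

theorem mem_commonKer {a : ℕ → Module.End ℂ V} {m : ℕ} {v : V} :
    v ∈ commonKer a m ↔ ∀ n < m, a n v = 0 := by
  simp [commonKer, Submodule.mem_iInf, Fin.forall_iff]

theorem commonKer_zero (a : ℕ → Module.End ℂ V) : commonKer a 0 = ⊤ :=
  iInf_of_empty _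

theorem mem_commonKer_succ {a : ℕ → Module.End ℂ V} {m : ℕ} {v : V} :
    v ∈ commonKer a (m + 1) ↔ v ∈ commonKer a m ∧ a m v = 0 := by
  simp only [mem_commonKer, Nat.lt_succ_iff_lt_or_eq]
  exact ⟨fun h => ⟨fun n hn => h n (Or.inl hn), h m (Or.inr rfl)⟩,
    fun h n hn => hn.elim (h.1 n) fun e => e ▸ h.2⟩

/-- Commuting pairs of lowering operators `a m` and raising operators `b m` of degree `d m`,
acting on a graded family of subspaces. -/
structure Ladder (E : ℤ × ℤ × ℤ → Submodule ℂ V) (a b : ℕ → Module.End ℂ V)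
    (d : ℕ → ℤ × ℤ × ℤ) : Prop where
  comm_lower : ∀ m n v, a m (a n v) = a n (a m v)
  comm_raise : ∀ m n, m ≠ n → ∀ v, a m (b n v) = b n (a m v)
  comm_self : ∀ m, ∃ κ : ℂ, κ ≠ 0 ∧ ∀ v, a m (b m v) = b m (a m v) + κ • v
  lower_mem : ∀ m g, ∀ v ∈ E g, a m v ∈ E (g - d m)
  raise_mem : ∀ m g, ∀ v ∈ E g, b m v ∈ E (g + d m)
  degree_pos : ∀ m, 0 < (d m).1
  eq_bot : ∀ g, g.1 < 0 → E g = ⊥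

namespace Ladder

variable {E : ℤ × ℤ × ℤ → Submodule ℂ V} {a b : ℕ → Module.End ℂ V} {d : ℕ → ℤ × ℤ × ℤ}

theorem lower_mem_commonKer (h : Ladder E a b d) (m k : ℕ) {v : V} (hv : v ∈ commonKer a m) :
    a k v ∈ commonKer a m := by
  rw [mem_commonKer] at hv ⊢
  intro n hn
  rw [h.comm_lower, hv n hn, map_zero]

theorem raise_mem_commonKer (h : Ladder E a b d) (m : ℕ) {v : V} (hv : v ∈ commonKer a m) :
    b m v ∈ commonKer a m := by
  rw [mem_commonKer] at hv ⊢
  intro n hn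
  rw [h.comm_raise n m hn.ne, hv n hn, map_zero]

/-- The preimage can be kept in any subspace stable under the pair. The dimension count takes `S =
⊤`; diagonalizing $L^h_0$ takes the span of its joint eigenspaces. -/
theorem exists_preimage (h : Ladder E a b d) (S : Submodule ℂ V) (m : ℕ)
    (ha : ∀ v ∈ S, a m v ∈ S) (hb : ∀ v ∈ S, b m v ∈ S) (g : ℤ × ℤ × ℤ) (w : V)
    (hw : w ∈ E g) (hwK : w ∈ commonKer a m) (hwS : w ∈ S) :
    ∃ u ∈ E (g + d m), u ∈ commonKer a m ∧ u ∈ S ∧ a m u = w := by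
  obtain ⟨κ, hκ, hab⟩ := h.comm_self m
  obtain ⟨u, ⟨hu1, hu2, hu3⟩, hu⟩ := exists_preimage_of_comm (fun g => E g ⊓ (commonKer a m ⊓ S))
    (a m) (b m) hκ hab (h.degree_pos m)
    (fun g v hv => ⟨h.lower_mem m g v hv.1, h.lower_mem_commonKer m m hv.2.1, ha v hv.2.2⟩)
    (fun g v hv => ⟨h.raise_mem m g v hv.1, h.raise_mem_commonKer m hv.2.1, hb v hv.2.2⟩)
    (fun g hg => by rw [h.eq_bot g hg, bot_inf_eq]) g w ⟨hw, hwK, hwS⟩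
  exact ⟨u, hu1, hu2, hu3, hu⟩

/-- Rank–nullity for `a m` on the common kernel of its predecessors, where it is still surjective
because its raising partner preserves that kernel. -/
theorem finrank_commonKer_succ (h : Ladder E a b d) (m : ℕ) (g : ℤ × ℤ × ℤ)
    [FiniteDimensional ℂ (E g)] :
    Module.finrank ℂ (E (g - d m) ⊓ commonKer a m : Submodule ℂ V)
      + Module.finrank ℂ (E g ⊓ commonKer a (m + 1) : Submodule ℂ V)
      = Module.finrank ℂ (E g ⊓ commonKer a m : Submodule ℂ V) := by
  have : FiniteDimensional ℂ (E g ⊓ commonKer a m : Submodule ℂ V) :=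
    Submodule.finiteDimensional_of_le inf_le_left
  let f : (E g ⊓ commonKer a m : Submodule ℂ V) →ₗ[ℂ]
      (E (g - d m) ⊓ commonKer a m : Submodule ℂ V) :=
    (a m).restrict fun v hv => ⟨h.lower_mem m g v hv.1, h.lower_mem_commonKer m m hv.2⟩
  have hf : Function.Surjective f := by
    rintro ⟨w, hw1, hw2⟩
    obtain ⟨u, hu1, hu2, -, hu⟩ := h.exists_preimage ⊤ m (by simp) (by simp) _ w hw1 hw2
      Submodule.mem_top
    rw [sub_add_cancel] at hu1
    exact ⟨⟨u, hu1, hu2⟩, Subtype.ext hu⟩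
  rw [← LinearMap.finrank_range_add_finrank_ker f, LinearMap.range_eq_top.mpr hf, finrank_top]
  congr 1
  refine LinearEquiv.finrank_eq (LinearEquiv.symm ?_)
  refine (Submodule.equivMapOfInjective (Submodule.subtype _) (Submodule.injective_subtype _)
    (LinearMap.ker f)).trans (LinearEquiv.ofEq _ _ ?_)
  ext v
  simp only [Submodule.mem_map, LinearMap.mem_ker, Submodule.subtype_apply, Subtype.exists,
    exists_and_right, exists_eq_right, Submodule.mem_inf, mem_commonKer_succ]
  constructor
  · rintro ⟨hv, hv'⟩
    exact ⟨hv.1, hv.2, congrArg Subtype.val hv'⟩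
  · rintro ⟨h1, h2, h3⟩
    exact ⟨⟨h1, h2⟩, Subtype.ext h3⟩

end Ladder

end Ladder

/-! ### Formal series: monomials, null families, infinite products -/

section Series

open Filter Topology

theorem coeff_qzr_mul (d : ℕ) (c l : ℤ) (f : SeriesQZR) (N : ℕ) (p : ℤ × ℤ) :
    (PowerSeries.coeff N (qzr d c l * f)).coeff p
      = if d ≤ N then (PowerSeries.coeff (N - d) f).coeff (p - (c, l)) else 0 := by
  rw [qzr, PowerSeries.monomial_eq_C_mul_X_pow, mul_assoc, PowerSeries.coeff_C_mul,
    PowerSeries.coeff_X_pow_mul']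
  split_ifs
  · rw [AddMonoidAlgebra.coeff_single_mul_apply, one_mul, neg_add_eq_sub]
  · rw [mul_zero]; rfl

theorem qzr_mul_qzr (d d' : ℕ) (c c' l l' : ℤ) :
    qzr d c l * qzr d' c' l' = qzr (d + d') (c + c') (l + l') := by
  rw [qzr, qzr, qzr, PowerSeries.monomial_mul_monomial, AddMonoidAlgebra.single_mul_single,
    Prod.mk_add_mk, one_mul]

theorem qzr_zero : qzr 0 0 0 = 1 := by
  rw [qzr, PowerSeries.monomial_zero_eq_C_apply]
  exact map_one _

theorem qzr_pow (d : ℕ) (c l : ℤ) (n : ℕ) : qzr d c l ^ n = qzr (n * d) (n * c) (n * l) := by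
  induction n with
  | zero => simp [qzr_zero]
  | succ n ih => rw [pow_succ, ih, qzr_mul_qzr]; congr 1 <;> push_cast <;> ring

theorem constantCoeff_qzr {d : ℕ} (hd : d ≠ 0) (c l : ℤ) :
    PowerSeries.constantCoeff (qzr d c l) = 0 := by
  rw [qzr, ← PowerSeries.coeff_zero_eq_constantCoeff_apply, PowerSeries.coeff_monomial,
    if_neg hd.symm]

/-- A family of formal series tends to zero if almost all of its members are divisible by any
given power of the variable. -/
def IsNull {ι : Type*} (f : ι → SeriesQZR) : Prop :=
  ∀ d : ℕ, {i | ¬ PowerSeries.X ^ d ∣ f i}.Finite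

theorem IsNull.summable {ι : Type*} {f : ι → SeriesQZR} (hf : IsNull f) : Summable f := by
  rw [PowerSeries.WithPiTopology.summable_iff_summable_coeff]
  intro n
  refine summable_of_hasFiniteSupport ((hf (n + 1)).subset fun i hi h => hi ?_)
  exact PowerSeries.X_pow_dvd_iff.mp h n n.lt_succ_self

theorem IsNull.mul {ι κ : Type*} {f : ι → SeriesQZR} {g : κ → SeriesQZR} (hf : IsNull f)
    (hg : IsNull g) : IsNull fun p : ι × κ => f p.1 * g p.2 := fun d =>
  ((hf d).prod (hg d)).subset fun _ hp =>
    ⟨fun h => hp (h.mul_right _), fun h => hp (h.mul_left _)⟩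

theorem IsNull.of_dvd {ι : Type*} {f g : ι → SeriesQZR} (hf : IsNull f) (h : ∀ i, f i ∣ g i) :
    IsNull g := fun d => (hf d).subset fun i hi h' => hi (h'.trans (h i))

theorem X_pow_dvd_qzr {d N : ℕ} (h : d ≤ N) (c l : ℤ) :
    (PowerSeries.X ^ d : SeriesQZR) ∣ qzr N c l := by
  rw [qzr, PowerSeries.monomial_eq_C_mul_X_pow]
  exact (pow_dvd_pow _ h).mul_left _

theorem isNull_qzr {ι : Type*} {d : ι → ℕ} (hd : ∀ N, {i | d i < N}.Finite) (c l : ι → ℤ) :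
    IsNull fun i => qzr (d i) (c i) (l i) := fun N => (hd N).subset fun _ hi =>
  not_le.mp fun h => hi (X_pow_dvd_qzr h _ _)

theorem multipliable_one_sub {x : ℕ → SeriesQZR} (hx : IsNull x) :
    Multipliable fun n => 1 - x n := by
  simp_rw [sub_eq_add_neg]
  refine PowerSeries.WithPiTopology.multipliable_one_add_of_tendsto_order_atTop_nhds_top _ ?_
  refine ENat.tendsto_nhds_top_iff_natCast_lt.mpr fun n => ?_
  have := (hx (n + 1)).eventually_cofinite_notMem
  rw [Nat.cofinite_eq_atTop] at this
  filter_upwards [this] with m hm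
  rw [PowerSeries.order_neg]
  have h : (PowerSeries.X ^ (n + 1) : SeriesQZR) ∣ x m := not_not.mp hm
  refine lt_of_lt_of_le ?_ (PowerSeries.nat_le_order _ (n + 1) (PowerSeries.X_pow_dvd_iff.mp h))
  exact_mod_cast n.lt_succ_self

theorem constantCoeff_tprod_one_sub {x : ℕ → SeriesQZR} (hx : IsNull x)
    (h0 : ∀ n, PowerSeries.constantCoeff (x n) = 0) :
    PowerSeries.constantCoeff (∏' n, (1 - x n)) = 1 := by
  rw [(multipliable_one_sub hx).map_tprod _ (PowerSeries.WithPiTopology.continuous_constantCoeff _)]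
  simp [h0]

theorem isUnit_tprod_one_sub {x : ℕ → SeriesQZR} (hx : IsNull x)
    (h0 : ∀ n, PowerSeries.constantCoeff (x n) = 0) : IsUnit (∏' n, (1 - x n)) := by
  rw [PowerSeries.isUnit_iff_constantCoeff, constantCoeff_tprod_one_sub hx h0]
  exact isUnit_one

/-- Solution of the recursion `F (m + 1) = (1 - x m) F m` in the limit. -/
theorem eq_tprod_mul_of_recursion {x : ℕ → SeriesQZR} (hx : IsNull x) {F : ℕ → SeriesQZR}
    (hF : ∀ m, F (m + 1) = (1 - x m) * F m) {H : SeriesQZR}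
    (hH : ∀ N, ∀ᶠ m in atTop, PowerSeries.coeff N (F m) = PowerSeries.coeff N H) :
    H = (∏' n, (1 - x n)) * F 0 := by
  have h1 : ∀ m, F m = (∏ n ∈ Finset.range m, (1 - x n)) * F 0 := fun m => by
    induction m with
    | zero => simp
    | succ m ih => rw [hF, ih, Finset.prod_range_succ]; ring
  have h2 : Tendsto F atTop (𝓝 ((∏' n, (1 - x n)) * F 0)) := by
    refine Tendsto.congr (fun m => (h1 m).symm) ?_
    exact (multipliable_one_sub hx).hasProd.tendsto_prod_nat.mul_const _
  refine tendsto_nhds_unique ?_ h2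
  rw [PowerSeries.WithPiTopology.tendsto_iff_coeff_tendsto]
  exact fun N => tendsto_const_nhds.congr' ((hH N).mono fun m hm => hm.symm)

theorem coeff_tsum_qzr {ι : Type*} (d : ι → ℕ) (hd : ∀ N, {i | d i < N}.Finite) (c l : ι → ℤ)
    (N : ℕ) (p : ℤ × ℤ) :
    (PowerSeries.coeff N (∑' i, qzr (d i) (c i) (l i))).coeff p
      = (Nat.card {i // d i = N ∧ (c i, l i) = p} : ℤ) := by
  have hs := (isNull_qzr hd c l).summable
  have hfin : {i | d i = N}.Finite := (hd (N + 1)).subset fun i (hi : d i = N) => by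
    change d i < N + 1; omega
  rw [hs.map_tsum (PowerSeries.coeff N) (PowerSeries.WithPiTopology.continuous_coeff _ N),
    tsum_eq_sum (s := hfin.toFinset)]
  · rw [AddMonoidAlgebra.coeff_sum, Finsupp.finsetSum_apply,
      Finset.sum_congr rfl (g := fun i => if (c i, l i) = p then (1 : ℤ) else 0)]
    · rw [Finset.sum_boole, Nat.subtype_card (hfin.toFinset.filter fun i => (c i, l i) = p)
        (fun i => by simp)]
    · intro i hi
      have hi' : d i = N := by simpa using hi
      rw [qzr, PowerSeries.coeff_monomial, if_pos hi'.symm, AddMonoidAlgebra.coeff_single,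
        Finsupp.single_apply]
  · intro i hi
    have hi' : N ≠ d i := fun h => hi (by simp [h])
    rw [qzr, PowerSeries.coeff_monomial, if_neg hi']

end Series

/-! ### Graded dimensions along a ladder -/

section GradedDim

open Filter

variable {V : Type*} [AddCommGroup V] [Module ℂ V]

/-- The series of the dimensions of the subspaces `E (N, c, l) ⊓ K`. -/
def gradedDim (E : ℤ × ℤ × ℤ → Submodule ℂ V) (hE : ∀ N, {p | E (N, p) ≠ ⊥}.Finite)
    (K : Submodule ℂ V) : SeriesQZR :=
  PowerSeries.mk fun N => AddMonoidAlgebra.ofCoeff <| Finsupp.ofSupportFinite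
    (fun p => (Module.finrank ℂ (E (N, p) ⊓ K : Submodule ℂ V) : ℤ))
    ((hE N).subset fun p hp h => hp (by
      change (Module.finrank ℂ (E (N, p) ⊓ K : Submodule ℂ V) : ℤ) = 0
      rw [h, bot_inf_eq, finrank_bot, Nat.cast_zero]))

theorem coeff_gradedDim (E : ℤ × ℤ × ℤ → Submodule ℂ V) (hE : ∀ N, {p | E (N, p) ≠ ⊥}.Finite)
    (K : Submodule ℂ V) (N : ℕ) (p : ℤ × ℤ) :
    (PowerSeries.coeff N (gradedDim E hE K)).coeff p
      = (Module.finrank ℂ (E (N, p) ⊓ K : Submodule ℂ V) : ℤ) := by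
  rw [gradedDim, PowerSeries.coeff_mk]
  rfl

/-- Rank–nullity becomes the recursion $F_{m+1}=(1-x_m)F_m$ for the series of the successive common
kernels. `H` is their coefficientwise stable limit. -/
theorem Ladder.gradedDim_eq_tprod_mul {E : ℤ × ℤ × ℤ → Submodule ℂ V}
    {a b : ℕ → Module.End ℂ V} {d : ℕ → ℕ} {c l : ℕ → ℤ}
    (h : Ladder E a b fun m => (d m, c m, l m))
    (hE : ∀ N, {p | E (N, p) ≠ ⊥}.Finite) [∀ g, FiniteDimensional ℂ (E g)]
    (hd : ∀ N, {i | d i < N}.Finite) (H : SeriesQZR)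
    (hH : ∀ N : ℕ, ∀ᶠ m in atTop, ∀ p, (PowerSeries.coeff N H).coeff p
      = (Module.finrank ℂ (E (N, p) ⊓ commonKer a m : Submodule ℂ V) : ℤ)) :
    H = (∏' m, (1 - qzr (d m) (c m) (l m))) * gradedDim E hE ⊤ := by
  rw [← commonKer_zero a]
  refine eq_tprod_mul_of_recursion (isNull_qzr hd c l)
    (F := fun m => gradedDim E hE (commonKer a m)) (fun m => ?_) fun N => ?_
  · ext N p
    have h1 := h.finrank_commonKer_succ m (N, p)
    rw [sub_mul, one_mul, map_sub, AddMonoidAlgebra.coeff_sub, Finsupp.sub_apply,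
      coeff_qzr_mul, coeff_gradedDim, coeff_gradedDim, ← h1]
    split_ifs with hN
    · rw [coeff_gradedDim, Nat.cast_sub hN]
      push_cast
      exact (add_sub_cancel_left _ _).symm
    · rw [h.eq_bot (((N : ℤ), p) - ((d m : ℤ), c m, l m)) (by rw [Prod.fst_sub]; dsimp only; omega),
        bot_inf_eq, finrank_bot]
      simp
  · filter_upwards [hH N] with m hm
    ext p
    rw [hm, coeff_gradedDim]

end GradedDim

/-! ### Monomials as eigenvectors of $2L_0$ and $h_0$ -/

section Monomials

open MvPolynomial

/-- The degree of a monomial, in units of half the eigenvalue of `2 L_0`. -/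
def monDegree (d : ℕ →₀ ℕ) : ℕ := d.sum fun k n => n * (2 * k + 1)

/-- The charge of a monomial. -/
def monCharge (d : ℕ →₀ ℕ) : ℤ := d.sum fun k n => n * (-1) ^ k

theorem finite_monDegree_le (N : ℕ) : {d | monDegree d ≤ N}.Finite := by
  refine ((Finset.range (N + 1)).finsupp fun _ => Finset.range (N + 1)).finite_toSet.subset ?_
  intro d (hd : monDegree d ≤ N)
  have h : ∀ k ∈ d.support, d k * (2 * k + 1) ≤ N := fun k hk =>
    (Finset.single_le_sum (f := fun k => d k * (2 * k + 1)) (fun _ _ => Nat.zero_le _) hk).trans hd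
  rw [Finset.mem_coe, Finset.mem_finsupp_iff]
  refine ⟨fun k hk => ?_, fun k _ => ?_⟩
  · have h1 := h k hk
    have h2 := Nat.pos_of_ne_zero (Finsupp.mem_support_iff.mp hk)
    rw [Finset.mem_range]
    nlinarith
  · rw [Finset.mem_range]
    by_cases hk : k ∈ d.support
    · have h1 := h k hk
      nlinarith
    · rw [Finsupp.notMem_support_iff.mp hk]
      omega

/-- Such an operator acts as the Euler operator $\sum_k w_kX_k\,\partial/\partial X_k$; each
variable contributes its weight times its exponent. -/
theorem apply_monomial_of_comm_X (D : Module.End ℂ Fock) (w : ℕ → ℂ) (h0 : D vacuum = 0)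
    (hD : ∀ k v, D (X k * v) = X k * D v + w k • (X k * v)) (d : ℕ →₀ ℕ) (r : ℂ) :
    D (monomial d r) = (d.sum fun k n => n * w k) • monomial d r := by
  have h1 : ∀ (k n : ℕ) v, D (X k ^ n * v) = X k ^ n * D v + (n * w k) • (X k ^ n * v) := by
    intro k n v
    induction n with
    | zero => simp
    | succ n ih =>
      rw [pow_succ', mul_assoc, hD, ih, mul_add, ← mul_assoc, mul_smul_comm, add_assoc,
        ← add_smul]
      congr 2
      push_cast
      ring
  have h2 : ∀ d e : ℕ →₀ ℕ, D (monomial (d + e) r)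
      = monomial d 1 * D (monomial e r) + (d.sum fun k n => n * w k) • monomial (d + e) r := by
    intro d
    induction d using Finsupp.induction_linear with
    | zero => intro e; simp
    | add d d' hd hd' =>
      intro e
      rw [add_assoc, hd, hd', Finsupp.sum_add_index' (by simp) (by intros; push_cast; ring),
        mul_add, ← mul_assoc, monomial_mul, mul_one, mul_smul_comm, monomial_mul, one_mul, add_smul]
      abel
    | single k n =>
      intro e
      rw [Finsupp.sum_single_index (by simp), add_comm, monomial_add_single, mul_comm, h1,
        X_pow_eq_monomial]
  have h3 := h2 d 0
  rw [add_zero] at h3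
  have h4 : D (monomial 0 r) = 0 := by
    rw [← C_apply, C_eq_smul_one, map_smul]
    exact (congrArg _ h0).trans (smul_zero _)
  rw [h3, h4, mul_zero, zero_add]

/-- An eigenvector can therefore only involve monomials with its own eigenvalue. -/
theorem coeff_of_diagonal {D : Module.End ℂ Fock} {μ : (ℕ →₀ ℕ) → ℂ}
    (hD : ∀ d r, D (monomial d r) = μ d • monomial d r) (d : ℕ →₀ ℕ) (v : Fock) :
    coeff d (D v) = μ d * coeff d v := by
  induction v using MvPolynomial.induction_on' with
  | monomial e r =>
    rw [hD, coeff_smul, coeff_monomial, smul_eq_mul]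
    split_ifs with h
    · rw [h]
    · simp
  | add p q hp hq => rw [map_add, coeff_add, coeff_add, hp, hq, mul_add]

theorem X_mul_eq_χ (k : ℕ) (v : Fock) : X k * v = χ (-1 - k) v := by
  rw [← χ_negSucc_apply]
  congr 2
  omega

theorem two_virL_monomial (d : ℕ →₀ ℕ) (r : ℂ) :
    ((2 : ℂ) • virL 0) (monomial d r) = ((monDegree d : ℂ) / 2) • monomial d r := by
  rw [apply_monomial_of_comm_X _ (fun k => (2 * (k : ℂ) + 1) / 2)]
  · congr 1
    rw [monDegree, Finsupp.sum, Finsupp.sum]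
    push_cast
    rw [Finset.sum_div]
    exact Finset.sum_congr rfl fun _ _ => by ring
  · rw [LinearMap.smul_apply, virL_vacuum, smul_zero]
  · intro k v
    rw [X_mul_eq_χ, X_mul_eq_χ, LinearMap.smul_apply, virL_χ, LinearMap.smul_apply, map_smul]
    push_cast
    module

theorem heis_zero_χ (m : ℤ) (v : Fock) :
    heis 0 (χ m v) = χ m (heis 0 v) + ((-1 : ℂ) ^ (m + 1)) • χ m v := by
  rw [heis_χ, mul_zero, add_zero]

theorem heis_zero_monomial (d : ℕ →₀ ℕ) (r : ℂ) :
    heis 0 (monomial d r) = (monCharge d : ℂ) • monomial d r := by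
  rw [apply_monomial_of_comm_X _ (fun k => (-1) ^ k)]
  · congr 1
    rw [monCharge, Finsupp.sum, Finsupp.sum]
    push_cast
    rfl
  · exact heis_vacuum 0 le_rfl
  · intro k v
    rw [X_mul_eq_χ, X_mul_eq_χ, heis_zero_χ]
    congr 2
    rw [show (-1 - k + 1 : ℤ) = -k by ring, zpow_neg, ← inv_zpow]
    norm_num

end Monomials

/-! ### Joint eigenspaces: finiteness and independence; `C = 0` leaves the grading by degree and
charge -/

section Grading

/-- The simultaneous eigenspaces of `2 L_0`, `h_0` and `C`, indexed by integers. -/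
def fockGrade (C : Module.End ℂ Fock) (g : ℤ × ℤ × ℤ) : Submodule ℂ Fock :=
  jointEigenspace ((2 : ℂ) • virL 0) (heis 0) C ((g.1 : ℂ) / 2) (g.2.1 : ℂ) ((g.2.2 : ℂ) / 2)

theorem mem_fockGrade {C : Module.End ℂ Fock} {g : ℤ × ℤ × ℤ} {v : Fock} :
    v ∈ fockGrade C g ↔ ((2 : ℂ) • virL 0) v = ((g.1 : ℂ) / 2) • v ∧
      heis 0 v = (g.2.1 : ℂ) • v ∧ C v = ((g.2.2 : ℂ) / 2) • v := by
  rw [fockGrade, jointEigenspace, Submodule.mem_inf, Submodule.mem_inf,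
    Module.End.mem_eigenspace_iff, Module.End.mem_eigenspace_iff, Module.End.mem_eigenspace_iff,
    and_assoc]

theorem mem_fockGrade_zero {N c : ℤ} {v : Fock} :
    v ∈ fockGrade 0 (N, c, 0) ↔ ((2 : ℂ) • virL 0) v = ((N : ℂ) / 2) • v ∧
      heis 0 v = (c : ℂ) • v := by
  simp [mem_fockGrade]

theorem fockGrade_le_zero (C : Module.End ℂ Fock) (g : ℤ × ℤ × ℤ) :
    fockGrade C g ≤ fockGrade 0 (g.1, g.2.1, 0) := fun _ hv =>
  mem_fockGrade_zero.mpr ⟨(mem_fockGrade.mp hv).1, (mem_fockGrade.mp hv).2.1⟩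

theorem monomial_mem_fockGrade (d : ℕ →₀ ℕ) (r : ℂ) :
    MvPolynomial.monomial d r ∈ fockGrade 0 (monDegree d, monCharge d, 0) :=
  mem_fockGrade_zero.mpr ⟨by rw [two_virL_monomial, Int.cast_natCast], heis_zero_monomial d r⟩

theorem degree_of_mem_fockGrade {C : Module.End ℂ Fock} {g : ℤ × ℤ × ℤ} {v : Fock}
    (hv : v ∈ fockGrade C g) {d : ℕ →₀ ℕ} (hd : MvPolynomial.coeff d v ≠ 0) :
    (monDegree d : ℤ) = g.1 := by
  have h := coeff_of_diagonal two_virL_monomial d v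
  rw [(mem_fockGrade.mp hv).1, MvPolynomial.coeff_smul, smul_eq_mul] at h
  have h' := mul_right_cancel₀ hd h
  have : ((g.1 : ℂ)) = ((monDegree d : ℤ) : ℂ) := by
    push_cast
    linear_combination 2 * h'
  exact (Int.cast_injective this).symm

theorem fockGrade_eq_bot (C : Module.End ℂ Fock) (g : ℤ × ℤ × ℤ) (hg : g.1 < 0) :
    fockGrade C g = ⊥ := by
  rw [Submodule.eq_bot_iff]
  intro v hv
  ext d
  by_contra hd
  have := degree_of_mem_fockGrade hv hd
  omega

theorem finiteDimensional_eigenspace_two_virL (N : ℤ) :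
    FiniteDimensional ℂ (((2 : ℂ) • virL 0).eigenspace ((N : ℂ) / 2)) := by
  have hfin : ((fun d => (MvPolynomial.monomial d (1 : ℂ))) ''
      {d | monDegree d ≤ N.toNat}).Finite := (finite_monDegree_le _).image _
  have := FiniteDimensional.span_of_finite ℂ hfin
  refine Submodule.finiteDimensional_of_le (S₂ := Submodule.span ℂ
    ((fun d => (MvPolynomial.monomial d (1 : ℂ))) '' {d | monDegree d ≤ N.toNat})) (fun v hv => ?_)
  rw [Module.End.mem_eigenspace_iff] at hv
  rw [v.as_sum]
  refine Submodule.sum_mem _ fun d hd => ?_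
  rw [← mul_one (MvPolynomial.coeff d v), ← smul_eq_mul, ← MvPolynomial.smul_monomial]
  refine Submodule.smul_mem _ _ (Submodule.subset_span ⟨d, ?_, rfl⟩)
  have h := coeff_of_diagonal two_virL_monomial d v
  rw [hv, MvPolynomial.coeff_smul, smul_eq_mul] at h
  have h' := mul_right_cancel₀ (MvPolynomial.mem_support_iff.mp hd) h
  have : (N : ℂ) = ((monDegree d : ℤ) : ℂ) := by
    push_cast
    linear_combination 2 * h'
  have := Int.cast_injective this
  change monDegree d ≤ N.toNat
  omega

instance finiteDimensional_fockGrade (C : Module.End ℂ Fock) (g : ℤ × ℤ × ℤ) :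
    FiniteDimensional ℂ (fockGrade C g) :=
  have := finiteDimensional_eigenspace_two_virL g.1
  Submodule.finiteDimensional_of_le (inf_le_left.trans inf_le_left)

theorem two_virL_heis (n : ℤ) (v : Fock) :
    ((2 : ℂ) • virL 0) (heis n v) = heis n (((2 : ℂ) • virL 0) v) - (2 * (n : ℂ)) • heis n v := by
  simp only [LinearMap.smul_apply, map_smul, heis_virL]
  module

/-- Joint generalized eigenspaces of commuting operators are independent. The eigenspaces lie inside
them, and the integer labels determine the eigenvalues injectively. -/
theorem iSupIndep_fockGrade {C : Module.End ℂ Fock} (hA : ∀ v, C (virL 0 v) = virL 0 (C v))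
    (hB : ∀ v, C (heis 0 v) = heis 0 (C v)) : iSupIndep (fockGrade C) := by
  let f : Fin 3 → Module.End ℂ Fock := ![(2 : ℂ) • virL 0, heis 0, C]
  have hAB : Commute ((2 : ℂ) • virL 0) (heis 0) := LinearMap.ext fun v => by
    simp only [Module.End.mul_apply, two_virL_heis]
    simp
  have hAC : Commute ((2 : ℂ) • virL 0) C := LinearMap.ext fun v => by
    simp [Module.End.mul_apply, hA]
  have hBC : Commute (heis 0) C := LinearMap.ext fun v => by
    simp [Module.End.mul_apply, hB]
  have hcomm : ∀ i j, Commute (f i) (f j) := by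
    intro i j
    fin_cases i <;> fin_cases j <;>
      first | exact Commute.refl _ | assumption | (apply Commute.symm; assumption)
  have h1 := Module.End.independent_iInf_maxGenEigenspace_of_forall_mapsTo f fun i j φ =>
    Module.End.mapsTo_maxGenEigenspace_of_comm (hcomm j i) φ
  let e : ℤ × ℤ × ℤ → Fin 3 → ℂ := fun g => ![(g.1 : ℂ) / 2, (g.2.1 : ℂ), (g.2.2 : ℂ) / 2]
  have he : e.Injective := by
    intro g g' h
    have h0 := congrFun h 0
    have h1 := congrFun h 1
    have h2 := congrFun h 2
    simp only [e, Matrix.cons_val_zero, Matrix.cons_val_one, Matrix.cons_val] at h0 h1 h2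
    have h0' : (g.1 : ℂ) = g'.1 := by linear_combination 2 * h0
    have h2' : (g.2.2 : ℂ) = g'.2.2 := by linear_combination 2 * h2
    exact Prod.ext (Int.cast_injective h0')
      (Prod.ext (Int.cast_injective h1) (Int.cast_injective h2'))
  refine (h1.comp he).mono fun g => ?_
  refine le_iInf fun i => ?_
  fin_cases i
  · exact (inf_le_left.trans inf_le_left).trans (Module.End.genEigenspace_le_maximal _ _ 1)
  · exact (inf_le_left.trans inf_le_right).trans (Module.End.genEigenspace_le_maximal _ _ 1)
  · exact inf_le_right.trans (Module.End.genEigenspace_le_maximal _ _ 1)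

/-- Nonzero vectors chosen from distinct joint eigenspaces are independent, and those of degree `N`
lie in one finite-dimensional eigenspace of $2L_0$. This makes the coefficients of the trace Laurent
polynomials. -/
theorem finite_fockGrade_ne_bot {C : Module.End ℂ Fock} (hC : iSupIndep (fockGrade C)) (N : ℤ) :
    {p | fockGrade C (N, p) ≠ ⊥}.Finite := by
  choose! v hv hv0 using fun p (hp : p ∈ {p | fockGrade C (N, p) ≠ ⊥}) =>
    Submodule.exists_mem_ne_zero_of_ne_bot hp
  have := finiteDimensional_eigenspace_two_virL N
  let u : {p | fockGrade C (N, p) ≠ ⊥} → ((2 : ℂ) • virL 0).eigenspace ((N : ℂ) / 2) :=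
    fun p => ⟨v p, (hv p p.2).1.1⟩
  have hind : LinearIndependent ℂ u := by
    refine LinearIndependent.of_comp (Submodule.subtype _) ?_
    refine iSupIndep.linearIndependent (fun p : {p | fockGrade C (N, p) ≠ ⊥} =>
      fockGrade C (N, p)) (hC.comp fun p q h => ?_) (fun p => hv p p.2) (fun p => hv0 p p.2)
    exact Subtype.ext (congrArg Prod.snd h)
  exact Set.finite_coe_iff.mp hind.finite

end Grading

/-! ### The Heisenberg ladder and the ladder of the $\chi_m$ -/

section Ladders

/-- The parameter `t` treats two gradings at once: `t = 0` for `C = 0` and `t = 2` for `C = virLh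
0`. -/
theorem heis_mem_fockGrade {C : Module.End ℂ Fock} {t : ℤ}
    (hC : ∀ (n : ℤ) v, C (heis n v) = heis n (C v) - ((t * n : ℤ) / 2 : ℂ) • heis n v) (n : ℤ)
    (g : ℤ × ℤ × ℤ) (v : Fock) (hv : v ∈ fockGrade C g) :
    heis n v ∈ fockGrade C (g - (4 * n, 0, t * n)) := by
  rw [mem_fockGrade] at hv ⊢
  rw [two_virL_heis, heis_zero_comm, hC, hv.1, hv.2.1, hv.2.2]
  simp only [map_smul, Prod.fst_sub, Prod.snd_sub]
  refine ⟨?_, ?_, ?_⟩ <;> push_cast <;> module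

theorem ladder_heis {C : Module.End ℂ Fock} {t : ℤ}
    (hC : ∀ (n : ℤ) v, C (heis n v) = heis n (C v) - ((t * n : ℤ) / 2 : ℂ) • heis n v) :
    Ladder (fockGrade C) (fun m => heis (m + 1)) (fun m => heis (-(m + 1)))
      (fun m => (4 * ((m : ℤ) + 1), 0, t * ((m : ℤ) + 1))) where
  comm_lower m n v := by
    rw [heis_comm_apply, if_neg (by omega), zero_smul, add_zero]
  comm_raise m n h v := by
    rw [heis_comm_apply, if_neg (by omega), zero_smul, add_zero]
  comm_self m := by
    refine ⟨((-(m + 1) : ℤ) : ℂ), Int.cast_ne_zero.mpr (by omega), fun v => ?_⟩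
    rw [heis_comm_apply, if_pos (by omega)]
  lower_mem m g v hv := heis_mem_fockGrade hC _ g v hv
  raise_mem m g v hv := by
    have := heis_mem_fockGrade hC (-(m + 1)) g v hv
    convert this using 2
    ext <;> simp <;> ring
  degree_pos m := by dsimp only; omega
  eq_bot g hg := fockGrade_eq_bot C g hg

theorem χ_mem_fockGrade (m : ℤ) (g : ℤ × ℤ × ℤ) (v : Fock) (hv : v ∈ fockGrade 0 g) (c : ℤ)
    (hc : (c : ℂ) = (-1) ^ m) : χ m v ∈ fockGrade 0 (g - (2 * m + 1, c, 0)) := by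
  rw [mem_fockGrade] at hv ⊢
  obtain ⟨h1, h2, h3⟩ := hv
  rw [LinearMap.zero_apply] at h3
  rw [heis_zero_χ, h2, LinearMap.smul_apply, virL_χ, smul_add, ← map_smul, ← LinearMap.smul_apply,
    h1, zpow_add_one₀ (by norm_num), ← hc, LinearMap.zero_apply]
  simp only [map_smul, Prod.fst_sub, Prod.snd_sub, sub_zero]
  rw [← map_smul _ ((g.2.2 : ℂ) / 2), ← h3, map_zero]
  refine ⟨?_, ?_, ?_⟩
  · push_cast; module
  · push_cast; module
  · rfl

theorem ladder_χ : Ladder (fockGrade 0) (fun m => χ m) (fun m => χ (-1 - m))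
    (fun m => (((2 * m + 1 : ℕ) : ℤ), (-1) ^ m, 0)) where
  comm_lower m n v := by
    rw [χ_apply_comm, if_neg (by omega), zero_smul, add_zero]
  comm_raise m n h v := by
    rw [χ_apply_comm, if_neg (by omega), zero_smul, add_zero]
  comm_self m := by
    refine ⟨(-1) ^ (-1 - (m : ℤ) + 1), zpow_ne_zero _ (by norm_num), fun v => ?_⟩
    rw [χ_apply_comm, if_pos (by omega)]
  lower_mem m g v hv := by
    have := χ_mem_fockGrade m g v hv ((-1) ^ m) (by push_cast; rw [zpow_natCast])
    convert this using 2
    push_cast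
    rfl
  raise_mem m g v hv := by
    have := χ_mem_fockGrade (-1 - m) g v hv (-(-1) ^ m) (by
      rw [zpow_sub₀ (by norm_num), zpow_natCast]
      rcases neg_one_pow_eq_or ℂ m with h | h <;> push_cast <;> rw [h] <;> norm_num)
    convert this using 2
    ext <;> simp
    ring
  degree_pos m := by dsimp only; omega
  eq_bot g hg := fockGrade_eq_bot 0 g hg

end Ladders

/-! ### Highest weight vectors and diagonalization of $L^h_0$ -/

section HighestWeight

open Filter

/-- The space of vectors annihilated by all `h_n`, `n > 0`. -/
def highestWeight : Submodule ℂ Fock := ⨅ n : ℕ, LinearMap.ker (heis (n + 1))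

theorem mem_highestWeight {v : Fock} : v ∈ highestWeight ↔ ∀ n : ℕ, heis (n + 1) v = 0 := by
  simp [highestWeight, Submodule.mem_iInf]

theorem Ladder.lower_eq_zero {V : Type*} [AddCommGroup V] [Module ℂ V]
    {E : ℤ × ℤ × ℤ → Submodule ℂ V} {a b : ℕ → Module.End ℂ V} {d : ℕ → ℤ × ℤ × ℤ}
    (h : Ladder E a b d) (m : ℕ) {g : ℤ × ℤ × ℤ} (hg : g.1 < (d m).1) {v : V} (hv : v ∈ E g) :
    a m v = 0 := by
  have := h.lower_mem m g v hv
  rwa [h.eq_bot _ (by rw [Prod.fst_sub]; omega), Submodule.mem_bot] at this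

/-- The operators from `m` on lower the degree by more than `m`, hence below zero. So in a fixed
degree finitely many conditions cut out the full common kernel. -/
theorem Ladder.lower_eq_zero_of_mem_commonKer {V : Type*} [AddCommGroup V] [Module ℂ V]
    {E : ℤ × ℤ × ℤ → Submodule ℂ V} {a b : ℕ → Module.End ℂ V} {d : ℕ → ℤ × ℤ × ℤ}
    (h : Ladder E a b d) (hd : ∀ m : ℕ, (m : ℤ) < (d m).1) {m : ℕ} {g : ℤ × ℤ × ℤ}
    (hg : g.1 ≤ m) {v : V} (hv : v ∈ E g) (hm : v ∈ commonKer a m) (n : ℕ) : a n v = 0 := by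
  rcases lt_or_ge n m with hn | hn
  · exact mem_commonKer.mp hm n hn
  · have := hd n
    exact h.lower_eq_zero n (by omega) hv

theorem heis_zero_operator (n : ℤ) (v : Fock) : (0 : Module.End ℂ Fock) (heis n v)
    = heis n ((0 : Module.End ℂ Fock) v) - ((0 * n : ℤ) / 2 : ℂ) • heis n v := by
  simp

theorem virLh_heis' (n : ℤ) (v : Fock) : virLh 0 (heis n v)
    = heis n (virLh 0 v) - ((2 * n : ℤ) / 2 : ℂ) • heis n v := by
  rw [virLh_heis]
  push_cast
  module

theorem fockGrade_inf_commonKer {C : Module.End ℂ Fock} {t : ℤ}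
    (hC : ∀ (n : ℤ) v, C (heis n v) = heis n (C v) - ((t * n : ℤ) / 2 : ℂ) • heis n v)
    {m : ℕ} {g : ℤ × ℤ × ℤ} (hg : g.1 ≤ m) :
    fockGrade C g ⊓ commonKer (fun m => heis (m + 1)) m = fockGrade C g ⊓ highestWeight := by
  ext v
  refine and_congr_right fun hv => ⟨fun h => mem_highestWeight.mpr fun n => ?_, fun h => ?_⟩
  · exact (ladder_heis hC).lower_eq_zero_of_mem_commonKer (fun m => by dsimp only; omega) hg hv h n
  · exact mem_commonKer.mpr fun n _ => mem_highestWeight.mp h n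

theorem virLh_of_mem_highestWeight {N c : ℤ} {v : Fock} (hv : v ∈ fockGrade 0 (N, c, 0))
    (h : v ∈ highestWeight) : v ∈ fockGrade (virLh 0) (N, c, -c ^ 2) := by
  have hv' := mem_fockGrade_zero.mp hv
  refine mem_fockGrade.mpr ⟨hv'.1, hv'.2, ?_⟩
  rw [virLh_of_highest_weight v (mem_highestWeight.mp h), hv'.2, map_smul, hv'.2]
  push_cast
  module

/-- Induction on the degree, correcting a vector by elements of the span of eigenspaces until all
$h_n$, $n>0$, kill it. The remainder is a highest weight vector and hence an eigenvector of $L^h_0$.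
-/
theorem fockGrade_zero_le_iSup_virLh (N c : ℤ) :
    fockGrade 0 (N, c, 0) ≤ ⨆ g, fockGrade (virLh 0) g := by
  have hS : ∀ (n : ℤ), ∀ v ∈ ⨆ g, fockGrade (virLh 0) g,
      heis n v ∈ ⨆ g, fockGrade (virLh 0) g := fun n => by
    have h : ⨆ g, fockGrade (virLh 0) g ≤ (⨆ g, fockGrade (virLh 0) g).comap (heis n) :=
      iSup_le fun g v hv => Submodule.mem_iSup_of_mem _ (heis_mem_fockGrade virLh_heis' n g v hv)
    exact h
  have hL := ladder_heis heis_zero_operator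
  have key : ∀ n : ℕ, ∀ N : ℤ, N < n →
      fockGrade 0 (N, c, 0) ≤ ⨆ g, fockGrade (virLh 0) g := by
    intro n
    induction n with
    | zero =>
      intro N hN
      rw [fockGrade_eq_bot _ _ (by exact_mod_cast hN)]
      exact bot_le
    | succ n ih =>
      intro N hN
      -- Here `k` bounds the number of annihilation conditions still missing, since `m ≥ N` of them
      -- suffice in degree `N`.
      have key2 : ∀ k m : ℕ, N ≤ m + k → ∀ v ∈ fockGrade 0 (N, c, 0),
          v ∈ commonKer (fun m => heis (m + 1)) m → v ∈ ⨆ g, fockGrade (virLh 0) g := by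
        intro k
        induction k with
        | zero =>
          intro m hm v hv hvm
          have h : v ∈ fockGrade 0 (N, c, 0) ⊓ highestWeight := by
            rw [← fockGrade_inf_commonKer heis_zero_operator (m := m) (by simpa using hm)]
            exact ⟨hv, hvm⟩
          exact Submodule.mem_iSup_of_mem _ (virLh_of_mem_highestWeight h.1 h.2)
        | succ k ihk =>
          intro m hm v hv hvm
          -- $h_{m+1}v$ has smaller degree, so it lies in the span by the outer induction and lifts
          -- to some `u` in the span. Then `v - u` satisfies one more annihilation condition.
          have hw := heis_mem_fockGrade heis_zero_operator (m + 1) _ v hv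
          have hwS := ih (N - 4 * (m + 1)) (by push_cast at hN; omega) (by simpa using hw)
          obtain ⟨u, hu1, hu2, hu3, hu⟩ := hL.exists_preimage (⨆ g, fockGrade (virLh 0) g) m
            (hS _) (hS _) _ _ (hL.lower_mem m _ v hv) (hL.lower_mem_commonKer m m hvm) hwS
          rw [sub_add_cancel] at hu1
          have h1 := ihk (m + 1) (by push_cast at hm ⊢; omega) (v - u)
            (Submodule.sub_mem _ hv hu1)
            (mem_commonKer_succ.mpr ⟨Submodule.sub_mem _ hvm hu2, by rw [map_sub, hu, sub_self]⟩)
          rw [← sub_add_cancel v u]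
          exact Submodule.add_mem _ h1 hu3
      intro v hv
      exact key2 N.toNat 0 (by omega) v hv (by rw [commonKer_zero]; trivial)
  exact key (N.toNat + 1) N (by omega)

theorem iSup_fockGrade_virLh : ⨆ g, fockGrade (virLh 0) g = ⊤ := by
  rw [eq_top_iff]
  intro v _
  rw [v.as_sum]
  exact Submodule.sum_mem _ fun d _ =>
    fockGrade_zero_le_iSup_virLh _ _ (monomial_mem_fockGrade d _)

theorem iSupIndep_virLh : iSupIndep (fockGrade (virLh 0)) :=
  iSupIndep_fockGrade virLh_virL virLh_heis_zero

theorem iSupIndep_zero : iSupIndep (fockGrade 0) :=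
  iSupIndep_fockGrade (by simp) (by simp)

theorem isInternal_jointEigenspace : DirectSum.IsInternal fun i : ℕ × ℤ × ℤ =>
    jointEigenspace ((2 : ℂ) • virL 0) (heis 0) (virLh 0) ((i.1 : ℂ) / 2) (i.2.1 : ℂ)
      ((i.2.2 : ℂ) / 2) := by
  have e : ∀ i : ℕ × ℤ × ℤ, jointEigenspace ((2 : ℂ) • virL 0) (heis 0) (virLh 0) ((i.1 : ℂ) / 2)
      (i.2.1 : ℂ) ((i.2.2 : ℂ) / 2) = fockGrade (virLh 0) (i.1, i.2) := fun i => by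
    simp [fockGrade]
  simp_rw [e]
  rw [DirectSum.isInternal_submodule_iff_iSupIndep_and_iSup_eq_top]
  refine ⟨iSupIndep_virLh.comp fun i j h => ?_, ?_⟩
  · simp only [Prod.mk.injEq, Nat.cast_inj] at h
    exact Prod.ext h.1 h.2
  · rw [eq_top_iff, ← iSup_fockGrade_virLh]
    refine iSup_le fun g => ?_
    by_cases hg : g.1 < 0
    · rw [fockGrade_eq_bot _ _ hg]
      exact bot_le
    · refine le_trans (le_of_eq ?_) (le_iSup _ (g.1.toNat, g.2))
      rw [Int.toNat_of_nonneg (not_lt.mp hg)]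

theorem finite_four_mul_lt (N : ℕ) : {i : ℕ | 4 * (i + 1) < N}.Finite :=
  (Set.finite_Iio N).subset fun i (hi : 4 * (i + 1) < N) => by
    rw [Set.mem_Iio]
    omega

/-- The generating function of the highest weight vectors for the Heisenberg algebra. -/
theorem gradedDim_highestWeight {C : Module.End ℂ Fock} {t : ℤ}
    (hC : ∀ (n : ℤ) v, C (heis n v) = heis n (C v) - ((t * n : ℤ) / 2 : ℂ) • heis n v)
    (hE : ∀ N, {p | fockGrade C (N, p) ≠ ⊥}.Finite) :
    gradedDim (fockGrade C) hE highestWeight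
      = (∏' m : ℕ, (1 - qzr (4 * (m + 1)) 0 (t * ((m : ℤ) + 1))))
        * gradedDim (fockGrade C) hE ⊤ := by
  have h : Ladder (fockGrade C) (fun m => heis (m + 1)) (fun m => heis (-(m + 1)))
      (fun m => (((4 * (m + 1) : ℕ) : ℤ), 0, t * ((m : ℤ) + 1))) := by
    simpa using ladder_heis hC
  refine h.gradedDim_eq_tprod_mul hE finite_four_mul_lt _ fun N => ?_
  filter_upwards [eventually_ge_atTop N] with m hm p
  rw [coeff_gradedDim, fockGrade_inf_commonKer hC (Nat.cast_le.mpr hm)]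

theorem virL_eq_zero_of_annihilated {v : Fock} (hv : ∀ n : ℕ, χ n v = 0) : virL 0 v = 0 := by
  have hv' : ∀ n : ℤ, 0 ≤ n → χ n v = 0 := fun n hn => by
    have := hv n.toNat
    rwa [Int.toNat_of_nonneg hn] at this
  refine finsum_eq_zero_of_forall_eq_zero fun i => ?_
  simp only [LinearMap.smul_apply, normalOrdered]
  split_ifs with h
  · rw [Module.End.mul_apply, hv' _ (by omega), map_zero, smul_zero]
  · rw [Module.End.mul_apply, hv' _ (by omega), map_zero, smul_zero]

/-- Each normally ordered term of $L_0$ ends in an annihilation mode, so $L_0v=0$; but $L_0$ has a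
nonzero eigenvalue on every nonconstant monomial. -/
theorem eq_smul_vacuum_of_annihilated {v : Fock} (hv : ∀ n : ℕ, χ n v = 0) :
    ∃ r : ℂ, v = r • vacuum := by
  refine ⟨MvPolynomial.coeff 0 v, ?_⟩
  ext d
  have h := coeff_of_diagonal two_virL_monomial d v
  rw [LinearMap.smul_apply, virL_eq_zero_of_annihilated hv, smul_zero, MvPolynomial.coeff_zero]
    at h
  rw [vacuum, MvPolynomial.coeff_smul, MvPolynomial.coeff_one]
  split_ifs with hd
  · simp [← hd]
  · rw [smul_zero]
    refine (mul_eq_zero.mp h.symm).resolve_left ?_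
    obtain ⟨k, hk⟩ := Finsupp.ne_iff.mp (Ne.symm hd)
    have : monDegree d ≠ 0 := by
      unfold monDegree Finsupp.sum
      rw [Ne, Finset.sum_eq_zero_iff]
      exact fun h0 => mul_ne_zero hk (by omega) (h0 k (Finsupp.mem_support_iff.mpr hk))
    simpa using this

theorem finrank_fockGrade_inf_commonKer_χ {m : ℕ} {g : ℤ × ℤ × ℤ} (hg : g.1 ≤ m) :
    Module.finrank ℂ (fockGrade 0 g ⊓ commonKer (fun m => χ m) m : Submodule ℂ Fock)
      = if g = 0 then 1 else 0 := by
  have h1 : ∀ v ∈ (fockGrade 0 g ⊓ commonKer (fun m => χ m) m : Submodule ℂ Fock),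
      ∃ r : ℂ, v = r • vacuum := fun v hv => eq_smul_vacuum_of_annihilated fun n =>
    ladder_χ.lower_eq_zero_of_mem_commonKer (fun m => by dsimp only; omega) hg hv.1 hv.2 n
  have h2 : ((2 : ℂ) • virL 0) vacuum = 0 := by
    rw [LinearMap.smul_apply, virL_vacuum, smul_zero]
  split_ifs with h
  · rw [← finrank_span_singleton (K := ℂ) (v := vacuum) one_ne_zero]
    refine congrArg (fun S : Submodule ℂ Fock => Module.finrank ℂ S)
      (le_antisymm (fun v hv => ?_) ?_)
    · obtain ⟨r, rfl⟩ := h1 v hv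
      exact Submodule.smul_mem _ _ (Submodule.mem_span_singleton_self _)
    · rw [Submodule.span_singleton_le_iff_mem]
      refine ⟨mem_fockGrade.mpr ?_, mem_commonKer.mpr fun n _ => χ_vacuum n (by omega)⟩
      rw [h2, heis_vacuum 0 le_rfl]
      simp [h]
  · rw [Submodule.finrank_eq_zero, Submodule.eq_bot_iff]
    intro v hv
    obtain ⟨r, rfl⟩ := h1 v hv
    obtain ⟨e1, e2, e3⟩ := mem_fockGrade.mp hv.1
    rw [map_smul, h2, smul_zero] at e1
    rw [map_smul, heis_vacuum 0 le_rfl, smul_zero] at e2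
    rw [LinearMap.zero_apply] at e3
    by_contra hne
    apply h
    have f1 := (smul_eq_zero.mp e1.symm).resolve_right hne
    have f2 := (smul_eq_zero.mp e2.symm).resolve_right hne
    have f3 := (smul_eq_zero.mp e3.symm).resolve_right hne
    exact Prod.ext (by simpa using f1) (Prod.ext (by simpa using f2) (by simpa using f3))

/-- The generating function of the Fock space, graded by degree and charge. -/
theorem tprod_mul_gradedDim_zero (hE : ∀ N, {p | fockGrade 0 (N, p) ≠ ⊥}.Finite) :
    (∏' k : ℕ, (1 - qzr (2 * k + 1) ((-1) ^ k) 0)) * gradedDim (fockGrade 0) hE ⊤ = 1 := by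
  refine (ladder_χ.gradedDim_eq_tprod_mul hE (fun N => (Set.finite_Iio N).subset fun i
    (hi : 2 * i + 1 < N) => by rw [Set.mem_Iio]; omega) 1 fun N => ?_).symm
  filter_upwards [eventually_ge_atTop N] with m hm p
  rw [finrank_fockGrade_inf_commonKer_χ (Nat.cast_le.mpr hm), PowerSeries.coeff_one]
  by_cases hN : N = 0
  · subst hN
    rw [if_pos rfl, AddMonoidAlgebra.one_def, AddMonoidAlgebra.coeff_single, Finsupp.single_apply]
    simp [Prod.ext_iff, eq_comm]
  · rw [if_neg hN, if_neg (by simp [Prod.ext_iff, hN])]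
    rfl

/-- The dimensions of the spaces of highest weight vectors, with and without the grading by the
eigenvalues of `L^h_0`. -/
theorem finrank_fockGrade_virLh_inf_highestWeight (N c l : ℤ) :
    Module.finrank ℂ (fockGrade (virLh 0) (N, c, l) ⊓ highestWeight : Submodule ℂ Fock)
      = if l = -c ^ 2 then
          Module.finrank ℂ (fockGrade 0 (N, c, 0) ⊓ highestWeight : Submodule ℂ Fock)
        else 0 := by
  split_ifs with h
  · subst h
    refine congrArg (fun S : Submodule ℂ Fock => Module.finrank ℂ S) ?_
    exact le_antisymm (inf_le_inf_right _ (fockGrade_le_zero _ _))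
      fun v hv => ⟨virLh_of_mem_highestWeight hv.1 hv.2, hv.2⟩
  · rw [Submodule.finrank_eq_zero, Submodule.eq_bot_iff]
    intro v hv
    have h1 := (mem_fockGrade.mp (virLh_of_mem_highestWeight (fockGrade_le_zero _ _ hv.1)
      hv.2)).2.2
    have h2 := (mem_fockGrade.mp hv.1).2.2
    rw [h2] at h1
    by_contra hne
    have h3 := smul_left_injective ℂ hne h1
    apply h
    have h4 : (l : ℂ) = ((-c ^ 2 : ℤ) : ℂ) := by linear_combination 2 * h3
    exact Int.cast_injective h4

end HighestWeight

/-! ### Euler's identity and the Durfee rectangle -/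

section QSeries

open Filter Finset

/-- If a summable family is grouped along the fibres of a map, its sum is the sum of the sums over
the fibres. -/
theorem tsum_eq_tsum_fiber {ι κ : Type*} {f : ι → SeriesQZR} (hf : Summable f) (g : ι → κ)
    {h : κ → SeriesQZR} (hh : ∀ k, HasSum (fun i : {i // g i = k} => f i) (h k)) :
    ∑' i, f i = ∑' k, h k := by
  have h1 : HasSum (f ∘ Equiv.sigmaFiberEquiv g) (∑' i, f i) :=
    (Equiv.hasSum_iff _).mpr hf.hasSum
  exact (HasSum.sigma h1 hh).tsum_eq.symm

/-- The variable `T = q²`. -/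
def qT : SeriesQZR := qzr 4 0 0

/-- The inverse `1 / ((1 - T) (1 - T²) ⋯ (1 - Tⁿ))` of the `q`-Pochhammer symbol. -/
def invPoch (n : ℕ) : SeriesQZR := Ring.inverse (∏ i ∈ range n, (1 - qT ^ (i + 1)))

theorem isUnit_one_sub_qT_pow (n : ℕ) : IsUnit (1 - qT ^ (n + 1)) := by
  rw [PowerSeries.isUnit_iff_constantCoeff, map_sub, map_pow, qT, constantCoeff_qzr (by norm_num)]
  simp

theorem invPoch_zero : invPoch 0 = 1 := by
  simp [invPoch]

theorem one_sub_mul_invPoch (n : ℕ) : (1 - qT ^ (n + 1)) * invPoch (n + 1) = invPoch n := by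
  have hu : IsUnit (∏ i ∈ range n, (1 - qT ^ (i + 1))) :=
    IsUnit.prod_iff.mpr fun i _ => isUnit_one_sub_qT_pow i
  have hu' : IsUnit (∏ i ∈ range (n + 1), (1 - qT ^ (i + 1))) :=
    IsUnit.prod_iff.mpr fun i _ => isUnit_one_sub_qT_pow i
  apply hu.mul_left_cancel
  rw [← mul_assoc, invPoch, invPoch, ← prod_range_succ, Ring.mul_inverse_cancel _ hu',
    Ring.mul_inverse_cancel _ hu]

/-- The finite form of the Durfee rectangle identity. -/
theorem sum_antidiagonal_invPoch (N c : ℕ) :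
    ∑ p ∈ antidiagonal N, qT ^ (p.1 * (p.1 + c)) * (invPoch p.1 * invPoch p.2 * invPoch (p.1 + c))
      = invPoch N * invPoch (N + c) := by
  induction N generalizing c with
  | zero => simp [invPoch_zero]
  | succ N ih =>
    apply (isUnit_one_sub_qT_pow N).mul_left_cancel
    -- For $p_1+p_2=N+1$, split $1-T^{N+1}=(1-T^{p_1})+T^{p_1}(1-T^{p_2})$. After shifting $p_1$ in
    -- the first sum and $p_2$ in the second, the two combine termwise into the identity for $N$ and
    -- $c+1$.
    have h1 : ∀ p ∈ antidiagonal (N + 1), (1 - qT ^ (N + 1)) *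
        (qT ^ (p.1 * (p.1 + c)) * (invPoch p.1 * invPoch p.2 * invPoch (p.1 + c)))
        = qT ^ (p.1 * (p.1 + c)) * (((1 - qT ^ p.1) * invPoch p.1) * invPoch p.2 *
          invPoch (p.1 + c)) + qT ^ (p.1 * (p.1 + c + 1)) * (invPoch p.1 *
          ((1 - qT ^ p.2) * invPoch p.2) * invPoch (p.1 + c)) := fun p hp => by
      rw [← mem_antidiagonal.mp hp]
      ring
    rw [mul_sum, sum_congr rfl h1, sum_add_distrib, Nat.sum_antidiagonal_succ,
      Nat.sum_antidiagonal_succ', ← mul_assoc (1 - qT ^ (N + 1)), one_sub_mul_invPoch,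
      show N + 1 + c = N + (c + 1) by ring, ← ih (c + 1)]
    simp only [pow_zero, sub_self, zero_mul, mul_zero, zero_add, one_sub_mul_invPoch]
    rw [← sum_add_distrib]
    refine sum_congr rfl fun p _ => ?_
    have h2 := one_sub_mul_invPoch (p.1 + c)
    rw [← h2, show p.1 + 1 + c = p.1 + c + 1 by ring, show p.1 + (c + 1) = p.1 + c + 1 by ring]
    ring

/-- The symmetric form of the Durfee identity: `c` is the difference of `S` and `M`, and `j` the
complement of the rectangle's shorter side. -/
theorem sum_range_invPoch (S M : ℕ) :
    ∑ j ∈ range (min S M + 1), qT ^ ((S - j) * (M - j)) *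
      (invPoch (S - j) * invPoch (M - j) * invPoch j) = invPoch S * invPoch M := by
  wlog h : M ≤ S generalizing S M
  · rw [mul_comm (invPoch S), ← this M S (le_of_not_ge h), min_comm]
    exact sum_congr rfl fun j _ => by rw [mul_comm (M - j), mul_comm (invPoch (M - j))]
  obtain ⟨c, rfl⟩ := Nat.exists_eq_add_of_le h
  rw [mul_comm (invPoch (M + c)), ← sum_antidiagonal_invPoch M c, min_eq_right h,
    ← Nat.sum_antidiagonal_swap, Nat.sum_antidiagonal_eq_sum_range_succ_mk]
  refine sum_congr rfl fun j hj => ?_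
  have hj' : j ≤ M := by rw [mem_range] at hj; omega
  simp only [Prod.fst_swap, Prod.snd_swap]
  rw [show M + c - j = M - j + c by omega, mul_comm (M - j + c)]
  ring

/-- A formal series with vanishing constant term has powers tending to zero. -/
theorem isNull_pow {x : SeriesQZR} (hx : PowerSeries.constantCoeff x = 0) :
    IsNull fun n : ℕ => x ^ n := fun d =>
  (Set.finite_Iio d).subset fun n hn => by
    by_contra h
    exact hn ((pow_dvd_pow _ (not_lt.mp h)).trans (pow_dvd_pow_of_dvd
      (PowerSeries.X_dvd_iff.mpr hx) n))

/-- Euler's `q`-exponential series `∑ xⁿ / ((1 - T) ⋯ (1 - Tⁿ))`. -/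
def qExp (x : SeriesQZR) : SeriesQZR := ∑' n : ℕ, x ^ n * invPoch n

theorem isNull_qExp {x : SeriesQZR} (hx : PowerSeries.constantCoeff x = 0) :
    IsNull fun n : ℕ => x ^ n * invPoch n :=
  (isNull_pow hx).of_dvd fun _ => dvd_mul_right _ _

theorem qExp_eq_one_add {x : SeriesQZR} (hx : PowerSeries.constantCoeff x = 0) :
    qExp x = 1 + x * ∑' n : ℕ, x ^ n * invPoch (n + 1) := by
  have h : Summable fun n : ℕ => x ^ n * invPoch (n + 1) :=
    ((isNull_pow hx).of_dvd fun n => dvd_mul_right _ (invPoch (n + 1))).summable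
  rw [qExp, (isNull_qExp hx).summable.tsum_eq_zero_add, ← h.tsum_mul_left]
  simp [invPoch_zero, pow_succ', mul_assoc]

/-- Replacing $x$ by $xT$ changes the $n$-th term by the factor $T^n$, and $1-T^n$ cancels the last
factor of the Pochhammer symbol. Iterating gives Euler's product, since `qExp (x * qT ^ m)` tends to
`1`. -/
theorem qExp_mul_qT {x : SeriesQZR} (hx : PowerSeries.constantCoeff x = 0) :
    qExp (x * qT) = (1 - x) * qExp x := by
  have hx' : PowerSeries.constantCoeff (x * qT) = 0 := by simp [hx]
  have h := (isNull_qExp hx).summable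
  have h' := (isNull_qExp hx').summable
  have h1 : qExp x - qExp (x * qT) = x * qExp x := by
    rw [qExp, qExp, ← h.tsum_sub h', (h.sub h').tsum_eq_zero_add, ← h.tsum_mul_left]
    simp only [pow_zero, sub_self, zero_add]
    refine tsum_congr fun n => ?_
    rw [← one_sub_mul_invPoch n]
    ring
  linear_combination -h1

/-- Euler's identity. -/
theorem tprod_mul_qExp {x : SeriesQZR} (hx : PowerSeries.constantCoeff x = 0) :
    (∏' n : ℕ, (1 - x * qT ^ n)) * qExp x = 1 := by
  have hT : PowerSeries.constantCoeff qT = 0 := constantCoeff_qzr (by norm_num) 0 0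
  have hc : ∀ m : ℕ, PowerSeries.constantCoeff (x * qT ^ m) = 0 := fun m => by simp [hx]
  have hnull : IsNull fun n : ℕ => x * qT ^ n := (isNull_pow hT).of_dvd fun _ => dvd_mul_left _ _
  have h := eq_tprod_mul_of_recursion (F := fun m => qExp (x * qT ^ m)) (H := 1) hnull
    (fun m => by rw [← qExp_mul_qT (hc m)]; ring_nf) (fun N => ?_)
  · simpa using h.symm
  · filter_upwards [eventually_ge_atTop (N + 1)] with m hm
    rw [qExp_eq_one_add (hc m), map_add, add_eq_left]
    refine PowerSeries.X_pow_dvd_iff.mp (?_ : PowerSeries.X ^ (N + 1) ∣ _) N N.lt_succ_self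
    refine Dvd.dvd.mul_right (Dvd.dvd.mul_left ?_ _) _
    exact (pow_dvd_pow _ hm).trans (pow_dvd_pow_of_dvd (PowerSeries.X_dvd_iff.mpr hT) m)

/-- The terms of the double series that is equal to `(ab)_∞ / ((a)_∞ (b)_∞)` for `ab = T`. -/
def doubleTerm (a b : SeriesQZR) (p : ℕ × ℕ) : SeriesQZR :=
  a ^ p.1 * b ^ p.2 * qT ^ (p.1 * p.2) * (invPoch p.1 * invPoch p.2)

theorem isNull_doubleTerm {a b : SeriesQZR} (ha : PowerSeries.constantCoeff a = 0)
    (hb : PowerSeries.constantCoeff b = 0) : IsNull (doubleTerm a b) :=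
  ((isNull_pow ha).mul (isNull_pow hb)).of_dvd fun p => ⟨qT ^ (p.1 * p.2) *
    (invPoch p.1 * invPoch p.2), by rw [doubleTerm]; ring⟩

/-- Here `qExp qT` is $\sum_j T^j/(T)_j$ with $T^j=(ab)^j$. Collecting the terms of the product with
total exponents $a^Sb^M$ leaves exactly the sum `sum_range_invPoch`. -/
theorem tsum_doubleTerm_mul_qExp {a b : SeriesQZR} (ha : PowerSeries.constantCoeff a = 0)
    (hb : PowerSeries.constantCoeff b = 0) (hab : a * b = qT) :
    (∑' p, doubleTerm a b p) * qExp qT = qExp a * qExp b := by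
  have hT : PowerSeries.constantCoeff qT = 0 := constantCoeff_qzr (by norm_num) 0 0
  have n1 := isNull_doubleTerm ha hb
  have n2 := isNull_qExp hT
  have n3 := isNull_qExp ha
  have n4 := isNull_qExp hb
  rw [qExp, qExp, qExp, n1.summable.tsum_mul_tsum n2.summable (n1.mul n2).summable,
    n3.summable.tsum_mul_tsum n4.summable (n3.mul n4).summable]
  refine tsum_eq_tsum_fiber (n1.mul n2).summable
    (fun z : (ℕ × ℕ) × ℕ => (z.1.1 + z.2, z.1.2 + z.2)) ?_
  rintro ⟨S, M⟩
  let F : Finset ((ℕ × ℕ) × ℕ) := (range (min S M + 1)).image fun j => ((S - j, M - j), j)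
  have hF : ∀ z : (ℕ × ℕ) × ℕ, z ∈ F ↔ (z.1.1 + z.2, z.1.2 + z.2) = (S, M) := by
    rintro ⟨⟨s, n⟩, j⟩
    simp only [F, mem_image, mem_range, Prod.mk.injEq]
    constructor
    · rintro ⟨i, hi, ⟨rfl, rfl⟩, rfl⟩
      omega
    · rintro ⟨rfl, rfl⟩
      exact ⟨j, by omega, ⟨by omega, by omega⟩, rfl⟩
  have hsum := F.hasSum (fun z : (ℕ × ℕ) × ℕ => doubleTerm a b z.1 * (qT ^ z.2 * invPoch z.2))
  have hval : ∑ z ∈ F, doubleTerm a b z.1 * (qT ^ z.2 * invPoch z.2)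
      = a ^ S * invPoch S * (b ^ M * invPoch M) := by
    rw [sum_image fun i _ j _ h => congrArg Prod.snd h]
    rw [show a ^ S * invPoch S * (b ^ M * invPoch M) = a ^ S * b ^ M * (invPoch S * invPoch M) by
      ring, ← sum_range_invPoch, mul_sum]
    refine sum_congr rfl fun j hj => ?_
    rw [mem_range] at hj
    obtain ⟨s, rfl⟩ := Nat.exists_eq_add_of_le' (show j ≤ S by omega)
    obtain ⟨n, rfl⟩ := Nat.exists_eq_add_of_le' (show j ≤ M by omega)
    simp only [doubleTerm, Nat.add_sub_cancel]
    rw [pow_add, pow_add, ← hab]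
    ring
  rw [hval] at hsum
  exact (Equiv.hasSum_iff (Equiv.subtypeEquivRight hF)).mp hsum

end QSeries

/-! ### Generating function of distinct bipartitions -/

section Bipartitions

open Finset

/-- The sum of the parts of a partition with `k` distinct parts, diminished by its minimal value
`k (k + 1) / 2`. -/
def excess (S : Finset ℕ+) : ℕ := (2 * ∑ i ∈ S, (i : ℕ) - S.card * (S.card + 1)) / 2

theorem two_mul_excess (S : Finset ℕ+) :
    2 * excess S + S.card * (S.card + 1) = 2 * ∑ i ∈ S, (i : ℕ) := by
  have h1 := DistinctBipartition.card_mul_card_add_one_le S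
  obtain ⟨k, hk⟩ := Nat.even_mul_succ_self S.card
  unfold excess
  omega

/-- All parts increased by one. -/
def shiftParts (S : Finset ℕ+) : Finset ℕ+ := S.map (addRightEmbedding 1)

theorem card_shiftParts (S : Finset ℕ+) : (shiftParts S).card = S.card := card_map _

theorem one_notMem_shiftParts (S : Finset ℕ+) : 1 ∉ shiftParts S := by
  intro h
  obtain ⟨i, -, hi⟩ := mem_map.mp h
  have h1 := congrArg (fun j : ℕ+ => (j : ℕ)) hi
  simp only [addRightEmbedding_apply, PNat.add_coe, PNat.one_coe] at h1
  have h2 := i.pos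
  omega

theorem sum_shiftParts (S : Finset ℕ+) :
    ∑ i ∈ shiftParts S, (i : ℕ) = ∑ i ∈ S, (i : ℕ) + S.card := by
  simp [shiftParts, sum_add_distrib]

theorem shiftParts_injective : Function.Injective shiftParts := map_injective _

theorem exists_shiftParts_eq {S : Finset ℕ+} (h : 1 ∉ S) : ∃ S', shiftParts S' = S := by
  refine ⟨S.preimage (addRightEmbedding 1) (addRightEmbedding 1).injective.injOn, ?_⟩
  ext i
  simp only [shiftParts, mem_map, mem_preimage, addRightEmbedding_apply]
  constructor
  · rintro ⟨j, hj, rfl⟩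
    exact hj
  · intro hi
    obtain ⟨j, rfl⟩ := PNat.exists_eq_succ_of_ne_one (fun h' : i = 1 => h (h' ▸ hi))
    exact ⟨j, hi, rfl⟩

theorem excess_shiftParts (S : Finset ℕ+) : excess (shiftParts S) = excess S + S.card := by
  have h1 := two_mul_excess (shiftParts S)
  have h2 := two_mul_excess S
  rw [card_shiftParts, sum_shiftParts] at h1
  omega

theorem card_insert_shiftParts (S : Finset ℕ+) : (insert 1 (shiftParts S)).card = S.card + 1 := by
  rw [card_insert_of_notMem (one_notMem_shiftParts S), card_shiftParts]

theorem excess_insert_shiftParts (S : Finset ℕ+) :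
    excess (insert 1 (shiftParts S)) = excess S := by
  have h1 := two_mul_excess (insert 1 (shiftParts S))
  have h2 := two_mul_excess S
  rw [card_insert_shiftParts, sum_insert (one_notMem_shiftParts S), sum_shiftParts,
    PNat.one_coe] at h1
  nlinarith

/-- Partitions into `k + 1` distinct parts either have no part `1` or arise from a partition into
`k` distinct parts by increasing all parts and adding the part `1`. -/
def shiftSum (k : ℕ) : {S : Finset ℕ+ // S.card = k + 1} ⊕ {S : Finset ℕ+ // S.card = k} →
    {S : Finset ℕ+ // S.card = k + 1} :=
  Sum.elim (fun S => ⟨shiftParts S, by rw [card_shiftParts, S.2]⟩)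
    (fun S => ⟨insert 1 (shiftParts S), by rw [card_insert_shiftParts, S.2]⟩)

theorem shiftSum_bijective (k : ℕ) : Function.Bijective (shiftSum k) := by
  constructor
  · rintro (⟨S, hS⟩ | ⟨S, hS⟩) (⟨S', hS'⟩ | ⟨S', hS'⟩) h <;>
      have h := congrArg Subtype.val h <;> simp only [shiftSum, Sum.elim_inl, Sum.elim_inr] at h
    · obtain rfl := shiftParts_injective h
      rfl
    · exact absurd (h ▸ mem_insert_self 1 _) (one_notMem_shiftParts S)
    · exact absurd (h.symm ▸ mem_insert_self 1 _) (one_notMem_shiftParts S')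
    · have h' := congrArg (fun X => X.erase 1) h
      simp only [erase_insert (one_notMem_shiftParts _)] at h'
      obtain rfl := shiftParts_injective h'
      rfl
  · rintro ⟨S, hS⟩
    by_cases h1 : 1 ∈ S
    · obtain ⟨S', hS'⟩ := exists_shiftParts_eq (notMem_erase 1 S)
      have h2 : S'.card = k := by
        rw [← card_shiftParts, hS', card_erase_of_mem h1, hS, Nat.add_sub_cancel]
      refine ⟨Sum.inr ⟨S', h2⟩, Subtype.ext ?_⟩
      change insert 1 (shiftParts S') = S
      rw [hS', insert_erase h1]
    · obtain ⟨S', rfl⟩ := exists_shiftParts_eq h1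
      exact ⟨Sum.inl ⟨S', by rw [← hS, card_shiftParts]⟩, rfl⟩

theorem finite_sum_parts_le (N : ℕ) : {S : Finset ℕ+ | ∑ i ∈ S, (i : ℕ) ≤ N}.Finite := by
  refine (Finset.Icc 1 N.succPNat).powerset.finite_toSet.subset fun S hS => ?_
  rw [mem_coe, mem_powerset]
  intro i hi
  have h : (i : ℕ) ≤ N :=
    (single_le_sum (f := fun i : ℕ+ => (i : ℕ)) (fun _ _ => Nat.zero_le _) hi).trans hS
  rw [mem_Icc, ← PNat.coe_le_coe i, Nat.succPNat_coe]
  exact ⟨one_le, h.trans (Nat.le_succ N)⟩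

theorem sum_parts_le (S : Finset ℕ+) :
    ∑ i ∈ S, (i : ℕ) ≤ excess S + S.card * (S.card + 1) := by
  have := two_mul_excess S
  omega

theorem isNull_excess (k : ℕ) :
    IsNull fun S : {S : Finset ℕ+ // S.card = k} => qT ^ excess S.1 := fun d => by
  refine (((finite_sum_parts_le (d + k * (k + 1))).preimage
    Subtype.val_injective.injOn)).subset ?_
  rintro ⟨S, hS⟩ h
  change ∑ i ∈ S, (i : ℕ) ≤ d + k * (k + 1)
  have h1 := sum_parts_le S
  have h2 : excess S < d := by
    by_contra h'
    exact h ((pow_dvd_pow _ (not_lt.mp h')).trans (pow_dvd_pow_of_dvd (PowerSeries.X_dvd_iff.mpr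
      (constantCoeff_qzr (by norm_num) 0 0)) _))
  rw [hS] at h1
  omega

/-- The generating function of partitions into `k` distinct parts. -/
theorem hasSum_excess (k : ℕ) :
    HasSum (fun S : {S : Finset ℕ+ // S.card = k} => qT ^ excess S.1) (invPoch k) := by
  induction k with
  | zero =>
    have : Unique {S : Finset ℕ+ // S.card = 0} :=
      ⟨⟨⟨∅, card_empty⟩⟩, fun S => Subtype.ext (card_eq_zero.mp S.2)⟩
    rw [invPoch_zero]
    convert hasSum_unique _ using 1
    symm
    rw [card_eq_zero.mp (default : {S : Finset ℕ+ // S.card = 0}).2]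
    simp [excess]
  | succ k ih =>
    have hs := (isNull_excess (k + 1)).summable
    -- With $G_k$ the series for $k$ parts, the bijection says $G_{k+1}=T^{k+1}G_{k+1}+G_k$, which
    -- is the recursion of `invPoch`.
    have h1 : HasSum ((fun S : {S : Finset ℕ+ // S.card = k + 1} => qT ^ excess S.1)
        ∘ shiftSum k) (qT ^ (k + 1) * (∑' S : {S : Finset ℕ+ // S.card = k + 1},
          qT ^ excess S.1) + invPoch k) := by
      refine HasSum.sum ?_ ?_
      · refine (congrArg (fun f => HasSum f _) (funext fun S => ?_)).mpr
          (hs.hasSum.mul_left (qT ^ (k + 1)))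
        change qT ^ excess (shiftParts S) = _
        rw [excess_shiftParts, S.2, pow_add, mul_comm]
      · refine (congrArg (fun f => HasSum f _) (funext fun S => ?_)).mpr ih
        change qT ^ excess (insert 1 (shiftParts S)) = _
        rw [excess_insert_shiftParts]
    have h2 := (Equiv.hasSum_iff (Equiv.ofBijective _ (shiftSum_bijective k))).mp h1
    have h3 : ∑' S : {S : Finset ℕ+ // S.card = k + 1}, qT ^ excess S.1 = invPoch (k + 1) := by
      apply (isUnit_one_sub_qT_pow k).mul_left_cancel
      rw [one_sub_mul_invPoch]
      linear_combination h2.tsum_eq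
    rw [← h3]
    exact hs.hasSum

namespace DistinctBipartition

/-- The minimal sums contribute $2n(n+1)$ and $2s(s+1)$ to $2\mathcal W$; subtracting $n(2n-1)$ and
$s(2s+1)$ leaves the linear terms $3n$ and $s$. They explain the bases $b=z^{-1}q^{3/2}$ and
$a=zq^{1/2}$. -/
theorem twoW_eq_excess (π : DistinctBipartition) : twoW π = 4 * excess π.1 + 4 * excess π.2
    + 4 * (π.2.card * π.1.card) + 3 * π.1.card + π.2.card := by
  have h1 := two_mul_excess π.1
  have h2 := two_mul_excess π.2
  have h := twoW_eq π
  have e : ((2 * W π : ℚ)) = ((4 * excess π.1 + 4 * excess π.2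
    + 4 * (π.2.card * π.1.card) + 3 * π.1.card + π.2.card : ℕ) : ℚ) := by
    have h1' := congrArg (Nat.cast : ℕ → ℚ) h1
    have h2' := congrArg (Nat.cast : ℕ → ℚ) h2
    unfold W weight
    push_cast at h1' h2' ⊢
    linear_combination -2 * h1' - 2 * h2'
  rw [e] at h
  exact_mod_cast h

theorem finite_twoW_lt (N : ℕ) : {π | twoW π < N}.Finite := by
  refine ((finite_sum_parts_le (N + N * (N + 1))).prod
    (finite_sum_parts_le (N + N * (N + 1)))).subset ?_
  intro π (hπ : twoW π < N)
  rw [twoW_eq_excess] at hπ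
  have h : ∀ S : Finset ℕ+, excess S ≤ N → S.card ≤ N →
      ∑ i ∈ S, (i : ℕ) ≤ N + N * (N + 1) := fun S h1 h2 =>
    (sum_parts_le S).trans (add_le_add h1 (Nat.mul_le_mul h2 (Nat.succ_le_succ h2)))
  exact ⟨h _ (by omega) (by omega), h _ (by omega) (by omega)⟩

theorem qzr_twoW (π : DistinctBipartition) : qzr (twoW π) (birank π) 0
    = qzr 1 1 0 ^ π.2.card * qzr 3 (-1) 0 ^ π.1.card * qT ^ (π.2.card * π.1.card)
      * (qT ^ excess π.2 * qT ^ excess π.1) := by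
  rw [twoW_eq_excess, birank, qT]
  simp only [qzr_pow, qzr_mul_qzr]
  congr 1 <;> push_cast <;> ring

end DistinctBipartition

/-- The generating function of bipartitions with distinct parts as a double series. -/
theorem tsum_qzr_twoW : ∑' π : DistinctBipartition, qzr π.twoW π.birank 0
    = ∑' p, doubleTerm (qzr 1 1 0) (qzr 3 (-1) 0) p := by
  refine tsum_eq_tsum_fiber (isNull_qzr DistinctBipartition.finite_twoW_lt _ _).summable
    (fun π => (π.2.card, π.1.card)) ?_
  rintro ⟨s, n⟩
  have h1 := (hasSum_excess s).mul (hasSum_excess n)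
    ((isNull_excess s).mul (isNull_excess n)).summable
  have h2 := h1.mul_left (qzr 1 1 0 ^ s * qzr 3 (-1) 0 ^ n * qT ^ (s * n))
  let e : {S : Finset ℕ+ // S.card = s} × {S : Finset ℕ+ // S.card = n} ≃
      {π : DistinctBipartition // (π.2.card, π.1.card) = (s, n)} :=
    { toFun := fun p => ⟨(p.2.1, p.1.1), Prod.ext p.1.2 p.2.2⟩
      invFun := fun π => (⟨π.1.2, congrArg Prod.fst π.2⟩, ⟨π.1.1, congrArg Prod.snd π.2⟩)
      left_inv := fun _ => rfl
      right_inv := fun _ => rfl }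
  refine (Equiv.hasSum_iff e).mp ?_
  refine (congrArg (fun f => HasSum f _) (funext fun p => ?_)).mpr h2
  change qzr (DistinctBipartition.twoW (p.2.1, p.1.1)) (DistinctBipartition.birank (p.2.1, p.1.1)) 0
    = _
  rw [DistinctBipartition.qzr_twoW]
  simp only [p.1.2, p.2.2]

end Bipartitions

/-! ### The series of highest weight vectors -/

section Trace

/-- The double series of the distinct bipartitions is the generating function of the highest
weight vectors. -/
theorem gradedDim_zero_highestWeight (hE : ∀ N, {p | fockGrade 0 (N, p) ≠ ⊥}.Finite) :
    gradedDim (fockGrade 0) hE highestWeight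
      = ∑' π : DistinctBipartition, qzr π.twoW π.birank 0 := by
  have hy : PowerSeries.constantCoeff (qzr 1 1 0) = 0 := constantCoeff_qzr (by norm_num) _ _
  have hy' : PowerSeries.constantCoeff (qzr 3 (-1) 0) = 0 := constantCoeff_qzr (by norm_num) _ _
  have hT : PowerSeries.constantCoeff qT = 0 := constantCoeff_qzr (by norm_num) _ _
  have hm : ∀ x : SeriesQZR, Multipliable fun n : ℕ => 1 - x * qT ^ n := fun x =>
    multipliable_one_sub ((isNull_pow hT).of_dvd fun _ => dvd_mul_left _ _)
  have h1 := tprod_mul_gradedDim_zero hE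
  -- Even `k` carry charge $+1$ and odd `k` charge $-1$, which separates the product into
  -- $(a)_\infty$ and $(b)_\infty$.
  have h2 : ∏' k : ℕ, (1 - qzr (2 * k + 1) ((-1) ^ k) 0)
      = (∏' n : ℕ, (1 - qzr 1 1 0 * qT ^ n)) * ∏' n : ℕ, (1 - qzr 3 (-1) 0 * qT ^ n) := by
    refine ((HasProd.even_mul_odd ?_ ?_).tprod_eq)
    · refine (congrArg (fun f => HasProd f _) (funext fun n => ?_)).mpr (hm _).hasProd
      rw [qT, qzr_pow, qzr_mul_qzr, pow_mul]
      congr 2 <;> ring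
    · refine (congrArg (fun f => HasProd f _) (funext fun n => ?_)).mpr (hm _).hasProd
      rw [qT, qzr_pow, qzr_mul_qzr, pow_succ, pow_mul]
      congr 2 <;> ring
  have h3 : ∏' m : ℕ, (1 - qzr (4 * (m + 1)) 0 (0 * ((m : ℤ) + 1)))
      = ∏' m : ℕ, (1 - qT * qT ^ m) := by
    refine tprod_congr fun m => ?_
    rw [qT, qzr_pow, qzr_mul_qzr]
    congr 2 <;> ring
  have e1 := tprod_mul_qExp hy
  have e2 := tprod_mul_qExp hy'
  have e3 := tprod_mul_qExp hT
  have e4 := tsum_doubleTerm_mul_qExp hy hy' (by rw [qzr_mul_qzr, qT]; rfl)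
  rw [gradedDim_highestWeight heis_zero_operator hE, h3, tsum_qzr_twoW]
  rw [h2] at h1
  -- What remains is ring algebra: $PP'U=PA=P'A'=QE=1$ and $BE=AA'$ imply $QU=B$.
  generalize gradedDim (fockGrade 0) hE ⊤ = U at *
  generalize (∏' n : ℕ, (1 - qzr 1 1 0 * qT ^ n)) = P at *
  generalize (∏' n : ℕ, (1 - qzr 3 (-1) 0 * qT ^ n)) = P' at *
  generalize (∏' m : ℕ, (1 - qT * qT ^ m)) = Q at *
  generalize qExp (qzr 1 1 0) = A at *
  generalize qExp (qzr 3 (-1) 0) = A' at *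
  generalize qExp qT = E at *
  generalize (∑' p, doubleTerm (qzr 1 1 0) (qzr 3 (-1) 0) p) = B at *
  have hU : U = A * A' := by
    linear_combination (A * A') * h1 - U * (P' * A' * e1 + e2)
  rw [hU, ← e4]
  linear_combination B * e3

/-- The generating function of the highest weight vectors, including the eigenvalues of
`L^h_0`. -/
theorem gradedDim_virLh_highestWeight (hE : ∀ N, {p | fockGrade (virLh 0) (N, p) ≠ ⊥}.Finite) :
    gradedDim (fockGrade (virLh 0)) hE highestWeight
      = ∑' π : DistinctBipartition, qzr π.twoW π.birank (-π.birank ^ 2) := by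
  have hE0 := finite_fockGrade_ne_bot iSupIndep_zero
  have h0 := gradedDim_zero_highestWeight hE0
  ext N ⟨c, l⟩
  rw [coeff_gradedDim, finrank_fockGrade_virLh_inf_highestWeight,
    coeff_tsum_qzr _ DistinctBipartition.finite_twoW_lt]
  split_ifs with hl
  · rw [← coeff_gradedDim (fockGrade 0) hE0 highestWeight N (c, 0), h0,
      coeff_tsum_qzr _ DistinctBipartition.finite_twoW_lt]
    congr 1
    -- Once the birank is `c`, the condition on the exponent of $r$ holds automatically, as `l = -c
    -- ^ 2`.
    refine Nat.card_congr (Equiv.subtypeEquivRight fun π => ?_)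
    simp only [Prod.mk.injEq, and_true]
    refine and_congr_right fun _ => ⟨fun h => ⟨h, by rw [h, hl]⟩, fun h => h.1⟩
  · have : IsEmpty {π : DistinctBipartition //
        π.twoW = N ∧ (π.birank, -π.birank ^ 2) = (c, l)} := by
      refine ⟨fun π => hl ?_⟩
      have h := π.2.2
      rw [Prod.mk.injEq] at h
      rw [← h.2, h.1]
    rw [Nat.card_of_isEmpty]

end Trace

end CKP

end

theorem mainTheorem3 :
    Multipliable (fun n : ℕ => 1 - CKP.qzr (4 * (n + 1)) 0 (2 * ((n : ℤ) + 1))) ∧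
    IsUnit (∏' n : ℕ, (1 - CKP.qzr (4 * (n + 1)) 0 (2 * ((n : ℤ) + 1)))) ∧
    Summable (fun π : CKP.DistinctBipartition =>
      CKP.qzr π.twoW π.birank (-π.birank ^ 2) *
        Ring.inverse (∏' n : ℕ, (1 - CKP.qzr (4 * (n + 1)) 0 (2 * ((n : ℤ) + 1))))) ∧
    CKP.HasTrace ((2 : ℂ) • CKP.virL 0) (CKP.heis 0) (CKP.virLh 0)
      (∑' π : CKP.DistinctBipartition,
        CKP.qzr π.twoW π.birank (-π.birank ^ 2) *
          Ring.inverse (∏' n : ℕ, (1 - CKP.qzr (4 * (n + 1)) 0 (2 * ((n : ℤ) + 1))))) := by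
  have hx : CKP.IsNull fun n : ℕ => CKP.qzr (4 * (n + 1)) 0 (2 * ((n : ℤ) + 1)) :=
    CKP.isNull_qzr CKP.finite_four_mul_lt _ _
  have hu := CKP.isUnit_tprod_one_sub hx fun n => CKP.constantCoeff_qzr (by omega) _ _
  have hs : Summable fun π : CKP.DistinctBipartition =>
      CKP.qzr π.twoW π.birank (-π.birank ^ 2) :=
    (CKP.isNull_qzr CKP.DistinctBipartition.finite_twoW_lt _ _).summable
  have hE := CKP.finite_fockGrade_ne_bot CKP.iSupIndep_virLh
  have htr : ∑' π : CKP.DistinctBipartition, CKP.qzr π.twoW π.birank (-π.birank ^ 2) *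
      Ring.inverse (∏' n : ℕ, (1 - CKP.qzr (4 * (n + 1)) 0 (2 * ((n : ℤ) + 1))))
      = CKP.gradedDim (CKP.fockGrade (CKP.virLh 0)) hE ⊤ := by
    -- The bipartition sum is the highest weight series, which equals the product times the full
    -- graded dimension; the inverse cancels the product.
    rw [hs.tsum_mul_right, ← CKP.gradedDim_virLh_highestWeight hE,
      CKP.gradedDim_highestWeight CKP.virLh_heis' hE, mul_comm, Ring.inverse_mul_cancel_left _ _ hu]
  refine ⟨CKP.multipliable_one_sub hx, hu, hs.mul_right _, ?_⟩
  rw [htr]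
  have e : ∀ (N : ℕ) (c l : ℤ), CKP.jointEigenspace ((2 : ℂ) • CKP.virL 0) (CKP.heis 0)
      (CKP.virLh 0) ((N : ℂ) / 2) (c : ℂ) ((l : ℂ) / 2)
      = CKP.fockGrade (CKP.virLh 0) (N, c, l) := fun N c l => by
    simp [CKP.fockGrade]
  refine ⟨CKP.isInternal_jointEigenspace, fun N c l => ?_, fun N c l => ?_⟩
  · rw [e]
    infer_instance
  · rw [e, CKP.coeff_gradedDim, inf_top_eq]
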